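/- Write $e(t)=e^{2\pi i t}$ and $\hat g(\xi)=\int_{\mathbb R} g(x)\,e(-\xi x)\,dx$. For $g:\mathbb R\to\mathbb C$, $\theta\in\mathbb R$ and an integer $k\ge 0$ put $\mathrm{Mod}_\theta g(x)=e(\theta x)\,g(x)$ and $g_k(t)=2^{-k}g(2^{-k}t)$. Let $\chi$ be a Schwartz function on $\mathbb R$ with $\mathbf 1_{[-1/4,1/4]}\le\hat\chi\le\mathbf 1_{[-1/2,1/2]}$, let $\Theta=\{\theta_1,\dots,\theta_N\}\subset\mathbb R$ be $1$-separated, i.e. $|\theta_i-\theta_j|>1$ for $i\ne j$, and for an integer $k_0\ge 0$ and $f\in L^2(\mathbb R)$ set \[ \mathcal M_{\Theta}f(x)=\mathcal M_{\Theta,k_0}f(x)=\sup_{k\ge k_0}\Big|\sum_{n\le N}\big((\mathrm{Mod}_{\theta_n}\chi_k)*f\big)(x)\Big| ,\] the supremum being over integers $k$. Then for every $\epsilon>0$ there is a constant $C_\epsilon$, depending only on $\epsilon$ (not on $\chi$, $k_0$, $N$, $\Theta$, $f$), such that \[ \|\mathcal M_{\Theta}f\|_{L^2(\mathbb R)}\le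 C_\epsilon\, N^{\epsilon}\,\|f\|_{L^2(\mathbb R)} .\] Moreover, there is an absolute constant $C$ such that, whenever $N\ge 2$, \[ \|\mathcal M_{\Theta}f\|_{L^2(\mathbb R)}\le C\,\log^2 N\,\|f\|_{L^2(\mathbb R)} .\] -/

import Mathlib

open MeasureTheory
open scoped ENNReal NNReal SchwartzMap FourierTransform Convolution

noncomputable section

namespace MultiFreq

/-- `1_{[-1/4,1/4]} ≤ χ̂ ≤ 1_{[-1/2,1/2]}` (in particular `χ̂` is real valued), where
`χ̂(ξ) = ∫ χ(x) e^{-2πixξ} dx`. -/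
def IsAdmissible (χ : 𝓢(ℝ, ℂ)) : Prop :=
  ∀ ξ : ℝ, (𝓕 (χ : ℝ → ℂ) ξ).im = 0 ∧
    Set.indicator (Set.Icc (-1 / 4 : ℝ) (1 / 4)) (fun _ => (1 : ℝ)) ξ ≤ (𝓕 (χ : ℝ → ℂ) ξ).re ∧
    (𝓕 (χ : ℝ → ℂ) ξ).re ≤ Set.indicator (Set.Icc (-1 / 2 : ℝ) (1 / 2)) (fun _ => (1 : ℝ)) ξ

/-- The `L¹`-normalized dyadic dilation `φ_k(t) = 2^{-k} φ(2^{-k} t)`. -/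
def dil (k : ℕ) (φ : ℝ → ℂ) : ℝ → ℂ :=
  fun t => ((2 : ℂ) ^ k)⁻¹ * φ (((2 : ℝ) ^ k)⁻¹ * t)

/-- The modulation `Mod_θ g(x) = e^{2πiθx} g(x)`. -/
def modulate (θ : ℝ) (g : ℝ → ℂ) : ℝ → ℂ :=
  fun x => Complex.exp (2 * Real.pi * Complex.I * (θ * x : ℝ)) * g x

/-- `Ξ_k f = ∑_{n ≤ N} (Mod_{θ_n} χ_k) * f`. -/
def Xi {N : ℕ} (χ : ℝ → ℂ) (θ : Fin N → ℝ) (k : ℕ) (f : ℝ → ℂ) : ℝ → ℂ :=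
  fun x => ∑ n : Fin N,
    (modulate (θ n) (dil k χ) ⋆[ContinuousLinearMap.mul ℂ ℂ, volume] f) x

/-- `sup_{k ≥ k₀} |Ξ_k f(x)|`, as an element of `[0, ∞]`. -/
def maximalFn {N : ℕ} (χ : ℝ → ℂ) (θ : Fin N → ℝ) (k₀ : ℕ) (f : ℝ → ℂ) : ℝ → ℝ≥0∞ :=
  fun x => ⨆ (k : ℕ) (_ : k₀ ≤ k), ‖Xi χ θ k f x‖ₑ

/-- `1`-separation: `|θ_i - θ_j| > 1` for `i ≠ j`. -/
def OneSeparated {N : ℕ} (θ : Fin N → ℝ) : Prop :=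
  ∀ i j : Fin N, i ≠ j → 1 < |θ i - θ j|

end MultiFreq

end

/-! Let `h n` be the inverse transform of the part of f̂ within 1/2 of θ_n, shifted to the origin.
Since 2^k ≥ 1, Ξ_k f = ∑ e(θ_n x) (χ_k * h_n), and disjointness of the bands gives ∑ ‖h_n‖₂² ≤
‖f‖₂². The kernel χ_k may be replaced by a tent kernel of width comparable to 2^k: the two
multipliers differ by O(min(s, 1/s)) at s = |2^k ξ|, which is square summable in k, so orthogonality
bounds the whole error by a multiple of ‖f‖₂ (`IsAdmissible.lintegral_tsum_Xi_sub_sq_le`).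

Convolution with the tent is an average, over translated dyadic grids, of block averages, so one
dyadic tree suffices (`lintegral_iSup_tentAvg_sq_le`). On a tree the averages of the vector g =
(h_n) form a martingale from coarse to fine, and the quantity to control is the supremum of |ℓ_x(v)|
over the values v on the path of x, with ℓ_x(v) = ∑ e(θ_n x) v_n. For fixed v the large sieve
(`lintegral_exponential_sum_sq_le`) bounds ℓ_x(v) in L² of a unit interval independently of N;
pointwise there is only |ℓ_x(v)| ≤ N ‖v‖.

These are combined by chaining (`lintegral_iSup_avg_sq_le`). For each i ≤ L, where N ≤ 2^L, an
anchor follows the path and moves only when it is farther than 2^{-i} times the running maximum from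
the current value. The difference of consecutive anchors changes only when one of them jumps, and is
then at most a multiple of a jump. At each level the squared jumps total at most ‖g‖² by Pythagoras.
The remaining error, at most N 2^{-L} times the running maximum, is controlled by Doob's inequality.
Cauchy–Schwarz over the L + 1 terms gives the norm bound O(L + 1) = O(1 + log N), which implies both
claims. -/

noncomputable section

namespace MultiFreq

/-! ### Greedy anchors along a path and pointwise chaining. -/

section Chaining

variable {H : Type*} [NormedAddCommGroup H]

/-- One greedy step: the anchor `a` moves to `v` when `v` is farther than `δ * M` from it. -/
def anchor (δ M : ℝ) (v a : H) : H :=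
  open Classical in if δ * M < ‖v - a‖ then v else a

/-- The running maximum of the norms along a path, started at `M`. -/
def runMax : ℝ → List H → ℝ
  | M, [] => M
  | M, v :: l => runMax (max M ‖v‖) l

/-- The sum of the squared jumps of the greedy anchor with threshold `δ` relative to the running
maximum. -/
def jumpSum (δ : ℝ) : ℝ → H → List H → ℝ
  | _, _, [] => 0
  | M, a, v :: l =>
    ‖anchor δ (max M ‖v‖) v a - a‖ ^ 2 + jumpSum δ (max M ‖v‖) (anchor δ (max M ‖v‖) v a) l

/-- The sum of `q` over the differences of two greedy anchors, with two thresholds, taken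
at the times at which at least one of them jumps. -/
def pairSum (q : H → ℝ≥0∞) (δ δ' : ℝ) : ℝ → H → H → List H → ℝ≥0∞
  | _, _, _, [] => 0
  | M, a, a', v :: l =>
    (open Classical in
      if anchor δ (max M ‖v‖) v a = a ∧ anchor δ' (max M ‖v‖) v a' = a' then 0
      else q (anchor δ' (max M ‖v‖) v a' - anchor δ (max M ‖v‖) v a)) +
    pairSum q δ δ' (max M ‖v‖) (anchor δ (max M ‖v‖) v a) (anchor δ' (max M ‖v‖) v a') l

lemma norm_sub_anchor_le {δ M : ℝ} (hδ : 0 ≤ δ) (hM : 0 ≤ M) (v a : H) :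
    ‖v - anchor δ M v a‖ ≤ δ * M := by
  unfold anchor
  split_ifs with h
  · simpa using mul_nonneg hδ hM
  · exact not_lt.1 h

lemma lt_norm_anchor_sub {δ M : ℝ} {v a : H} (h : anchor δ M v a ≠ a) :
    δ * M < ‖anchor δ M v a - a‖ := by
  unfold anchor at h ⊢
  split_ifs with h'
  · exact h'
  · simp [h'] at h

/-- At threshold 1 the anchor never leaves 0, so the telescoping sum of the chaining starts at zero.
-/
lemma anchor_one_zero (M : ℝ) (v : H) : anchor 1 (max M ‖v‖) v 0 = 0 := by
  unfold anchor
  rw [if_neg]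
  simp

lemma le_runMax (M : ℝ) (l : List H) : M ≤ runMax M l := by
  induction l generalizing M with
  | nil => exact le_rfl
  | cons v l ih => exact (le_max_left _ _).trans (ih _)

lemma jumpSum_nonneg (δ M : ℝ) (a : H) (l : List H) : 0 ≤ jumpSum δ M a l := by
  induction l generalizing M a with
  | nil => exact le_rfl
  | cons v l ih => exact add_nonneg (by positivity) (ih _ _)

/-- Both new anchors are close to the current value, within δM' and δM'/2, hence within 3 · δM'/2 of
each other, while any jump exceeds δM'/2. Squaring the ratio 3 gives the factor 9. -/
lemma pairSum_le_jumpSum {q : H → ℝ≥0∞} {C : ℝ} (hC : 0 ≤ C)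
    (hq : ∀ p, q p ≤ ENNReal.ofReal (C * ‖p‖ ^ 2)) {δ : ℝ} (hδ : 0 ≤ δ) {M : ℝ} (hM : 0 ≤ M)
    (a a' : H) (l : List H) :
    pairSum q δ (δ / 2) M a a' l ≤
      ENNReal.ofReal (9 * C * (jumpSum δ M a l + jumpSum (δ / 2) M a' l)) := by
  induction l generalizing M a a' with
  | nil => simp [pairSum]
  | cons v l ih =>
    simp only [pairSum, jumpSum]
    have hM' : 0 ≤ max M ‖v‖ := le_max_of_le_left hM
    set M' := max M ‖v‖
    set b := anchor δ M' v a with hb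
    set b' := anchor (δ / 2) M' v a' with hb'
    have hJ := jumpSum_nonneg δ M' b l
    have hJ' := jumpSum_nonneg (δ / 2) M' b' l
    rw [show 9 * C * (‖b - a‖ ^ 2 + jumpSum δ M' b l + (‖b' - a'‖ ^ 2 + jumpSum (δ / 2) M' b' l))
      = 9 * C * (‖b - a‖ ^ 2 + ‖b' - a'‖ ^ 2)
        + 9 * C * (jumpSum δ M' b l + jumpSum (δ / 2) M' b' l) by ring,
      ENNReal.ofReal_add (by positivity) (by positivity)]
    refine add_le_add ?_ (ih hM' b b')
    split_ifs with h
    · simp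
    · refine (hq _).trans (ENNReal.ofReal_le_ofReal ?_)
      have h1 : ‖v - b‖ ≤ δ * M' := norm_sub_anchor_le hδ hM' v a
      have h2 : ‖v - b'‖ ≤ δ / 2 * M' := norm_sub_anchor_le (by positivity) hM' v a'
      have h3 : ‖b' - b‖ ≤ 3 * (δ / 2 * M') := by
        calc ‖b' - b‖ = ‖(v - b) - (v - b')‖ := by congr 1; abel
          _ ≤ ‖v - b‖ + ‖v - b'‖ := norm_sub_le _ _
          _ ≤ _ := by linarith
      have h0 : 0 ≤ δ / 2 * M' := by positivity
      have h4 : (δ / 2 * M') ^ 2 ≤ ‖b - a‖ ^ 2 + ‖b' - a'‖ ^ 2 := by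
        rcases not_and_or.1 h with h | h
        · have := lt_norm_anchor_sub h
          have : δ / 2 * M' ≤ ‖b - a‖ := by
            rw [← hb] at this; linarith
          nlinarith [sq_nonneg ‖b' - a'‖, pow_le_pow_left₀ h0 this 2]
        · have := (lt_norm_anchor_sub h).le
          rw [← hb'] at this
          nlinarith [sq_nonneg ‖b - a‖, pow_le_pow_left₀ h0 this 2]
      have h5 : ‖b' - b‖ ^ 2 ≤ 9 * (δ / 2 * M') ^ 2 := by
        have := pow_le_pow_left₀ (norm_nonneg _) h3 2
        linarith [mul_pow 3 (δ / 2 * M') 2]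
      calc C * ‖b' - b‖ ^ 2 ≤ C * (9 * (‖b - a‖ ^ 2 + ‖b' - a'‖ ^ 2)) := by gcongr; linarith
        _ = _ := by ring

/-- The anchors depend on the path only and not on x, so every term evaluates `q x` at a fixed
vector. -/
lemma lintegral_pairSum {α : Type*} [MeasurableSpace α] (μ : Measure α) {q : α → H → ℝ≥0∞}
    (hq : ∀ p, Measurable fun x => q x p) (δ δ' M : ℝ) (a a' : H) (l : List H) :
    (Measurable fun x => pairSum (q x) δ δ' M a a' l) ∧
    ∫⁻ x, pairSum (q x) δ δ' M a a' l ∂μ = pairSum (fun p => ∫⁻ x, q x p ∂μ) δ δ' M a a' l := by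
  induction l generalizing M a a' with
  | nil => simp [pairSum]
  | cons v l ih =>
    simp only [pairSum]
    split_ifs with h
    · simpa using ih _ _ _
    · refine ⟨(hq _).add (ih _ _ _).1, ?_⟩
      rw [lintegral_add_left (hq _), (ih _ _ _).2]

/-- Chaining along the greedy anchors with thresholds `2⁻ⁱ`, `i ≤ L`. -/
lemma enorm_le_chain {E : Type*} [NormedAddCommGroup E] (ℓ : H →+ E) {B : ℝ} (hB : 0 ≤ B)
    (hℓ : ∀ v, ‖ℓ v‖ ≤ B * ‖v‖) (L : ℕ) {M : ℝ} (hM : 0 ≤ M) (a : ℕ → H) (ha : a 0 = 0)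
    (l : List H) (v : H) (hv : v ∈ l) :
    ‖ℓ v‖ₑ ≤ ENNReal.ofReal (B * (2⁻¹ ^ L * runMax M l)) +
      ∑ i ∈ Finset.range L, (‖ℓ (a (i + 1) - a i)‖ₑ ^ 2 +
        pairSum (fun p => ‖ℓ p‖ₑ ^ 2) (2⁻¹ ^ i) (2⁻¹ ^ (i + 1)) M (a i) (a (i + 1)) l) ^
          (1 / 2 : ℝ) := by
  induction l generalizing M a with
  | nil => simp at hv
  | cons w l ih =>
    have hM' : 0 ≤ max M ‖w‖ := le_max_of_le_left hM
    set b : ℕ → H := fun i => anchor (2⁻¹ ^ i) (max M ‖w‖) w (a i) with hb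
    have hb0 : b 0 = 0 := by simp [hb, ha, anchor_one_zero]
    -- The current difference together with the future ones can only lose terms along the path:
    -- either neither anchor moves, or the new difference is already a term of `pairSum`.
    have key : ∀ i, ‖ℓ (b (i + 1) - b i)‖ₑ ^ 2 + pairSum (fun p => ‖ℓ p‖ₑ ^ 2) (2⁻¹ ^ i)
        (2⁻¹ ^ (i + 1)) (max M ‖w‖) (b i) (b (i + 1)) l ≤ ‖ℓ (a (i + 1) - a i)‖ₑ ^ 2 +
        pairSum (fun p => ‖ℓ p‖ₑ ^ 2) (2⁻¹ ^ i) (2⁻¹ ^ (i + 1)) M (a i) (a (i + 1)) (w :: l) := by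
      intro i
      simp only [pairSum]
      split_ifs with h
      · simp only [hb, h.1, h.2, zero_add]; exact le_rfl
      · simp only [hb]; exact le_add_self
    rcases List.mem_cons.1 hv with rfl | hv
    · have h1 : ‖ℓ v‖ₑ ≤ ‖ℓ (v - b L)‖ₑ + ∑ i ∈ Finset.range L, ‖ℓ (b (i + 1) - b i)‖ₑ := by
        have : v = (v - b L) + ∑ i ∈ Finset.range L, (b (i + 1) - b i) := by
          rw [Finset.sum_range_sub, hb0]; abel
        calc ‖ℓ v‖ₑ = ‖ℓ (v - b L) + ∑ i ∈ Finset.range L, ℓ (b (i + 1) - b i)‖ₑ := by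
              rw [← map_sum, ← map_add, ← this]
          _ ≤ _ := (enorm_add_le _ _).trans (add_le_add le_rfl (enorm_sum_le _ _))
      refine h1.trans (add_le_add ?_ (Finset.sum_le_sum fun i _ => ?_))
      · rw [← ofReal_norm]
        refine ENNReal.ofReal_le_ofReal ((hℓ _).trans ?_)
        refine mul_le_mul_of_nonneg_left ?_ hB
        refine (norm_sub_anchor_le (by positivity) hM' v (a L)).trans ?_
        exact mul_le_mul_of_nonneg_left (le_runMax _ _) (by positivity)
      · refine le_trans ?_ (ENNReal.rpow_le_rpow (key i) (by norm_num))
        refine le_trans (le_of_eq ?_) (ENNReal.rpow_le_rpow le_self_add (by norm_num))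
        rw [← ENNReal.rpow_natCast, ← ENNReal.rpow_mul]; norm_num
    · refine (ih hM' b hb0 hv).trans (add_le_add le_rfl (Finset.sum_le_sum fun i _ => ?_))
      exact ENNReal.rpow_le_rpow (key i) (by norm_num)

end Chaining

/-! ### The chained bound integrated over one leaf. -/

section Leaves

variable {H : Type*} [NormedAddCommGroup H]

/-- `∫ sup² ≤ (L + 1) (max² + jumps)` for the values of linear functionals along one path. -/
lemma lintegral_iSup_mem_sq_le {E α : Type*} [NormedAddCommGroup E] [MeasurableSpace α]
    {μ : Measure α} (hμ : μ Set.univ ≤ 1) (ℓ : α → H →+ E) {B C : ℝ} (hB : 0 ≤ B) (hC : 0 ≤ C)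
    (hℓm : ∀ v, Measurable fun x => ‖ℓ x v‖ₑ) (hℓ : ∀ x v, ‖ℓ x v‖ ≤ B * ‖v‖)
    (hℓ2 : ∀ v, ∫⁻ x, ‖ℓ x v‖ₑ ^ 2 ∂μ ≤ ENNReal.ofReal (C * ‖v‖ ^ 2))
    {L : ℕ} (hL : B ≤ 2 ^ L) (l : List H) :
    ∫⁻ x, (⨆ v ∈ l, ‖ℓ x v‖ₑ) ^ 2 ∂μ ≤ ENNReal.ofReal ((L + 1) * (runMax 0 l ^ 2 +
      ∑ i ∈ Finset.range L,
        9 * C * (jumpSum (2⁻¹ ^ i) 0 0 l + jumpSum (2⁻¹ ^ (i + 1)) 0 0 l))) := by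
  have hR : 0 ≤ runMax 0 l := le_runMax 0 l
  set P : ℕ → α → ℝ≥0∞ := fun i x =>
    pairSum (fun p => ‖ℓ x p‖ₑ ^ 2) (2⁻¹ ^ i) (2⁻¹ ^ (i + 1)) 0 0 0 l with hP
  have hPm : ∀ i, Measurable (P i) := fun i =>
    (lintegral_pairSum μ (fun p => (hℓm p).pow_const 2) _ _ _ _ _ _).1
  have hPi : ∀ i, ∫⁻ x, P i x ∂μ ≤
      ENNReal.ofReal (9 * C * (jumpSum (2⁻¹ ^ i) 0 0 l + jumpSum (2⁻¹ ^ (i + 1)) 0 0 l)) := by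
    intro i
    rw [hP, (lintegral_pairSum μ (fun p => (hℓm p).pow_const 2) _ _ _ _ _ _).2,
      show (2⁻¹ : ℝ) ^ (i + 1) = 2⁻¹ ^ i / 2 by ring]
    exact pairSum_le_jumpSum hC hℓ2 (by positivity) le_rfl _ _ _
  have hpt : ∀ x, (⨆ v ∈ l, ‖ℓ x v‖ₑ) ^ 2 ≤
      (L + 1) * (ENNReal.ofReal (runMax 0 l ^ 2) + ∑ i ∈ Finset.range L, P i x) := by
    intro x
    have h1 : (⨆ v ∈ l, ‖ℓ x v‖ₑ) ≤ ∑ i ∈ Finset.range (L + 1),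
        (if i = L then ENNReal.ofReal (runMax 0 l) else P i x ^ (1 / 2 : ℝ)) := by
      refine iSup₂_le fun v hv => ?_
      refine (enorm_le_chain (ℓ x) hB (hℓ x) L le_rfl (fun _ => 0) rfl l v hv).trans ?_
      rw [Finset.sum_range_succ, if_pos rfl, add_comm]
      refine add_le_add (Finset.sum_le_sum fun i hi => ?_) (ENNReal.ofReal_le_ofReal ?_)
      · rw [if_neg (Finset.mem_range.1 hi).ne]
        simp [hP]
      -- `B ≤ 2 ^ L` makes the trivial bound harmless at the finest threshold.
      · rw [← mul_assoc]
        refine mul_le_of_le_one_left hR ?_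
        rw [inv_pow, ← div_eq_mul_inv]
        exact div_le_one_of_le₀ hL (by positivity)
    calc (⨆ v ∈ l, ‖ℓ x v‖ₑ) ^ 2 ≤ (∑ i ∈ Finset.range (L + 1),
        (if i = L then ENNReal.ofReal (runMax 0 l) else P i x ^ (1 / 2 : ℝ))) ^ (2 : ℝ) := by
          rw [← ENNReal.rpow_natCast]; exact ENNReal.rpow_le_rpow h1 (by norm_num)
      _ ≤ _ := ENNReal.rpow_sum_le_const_mul_sum_rpow _ _ (by norm_num)
      _ = _ := by
        rw [Finset.sum_range_succ, if_pos rfl, add_comm (Finset.sum _ _)]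
        congr 1
        · norm_num
        · congr 1
          · rw [ENNReal.ofReal_pow hR]; norm_cast
          · refine Finset.sum_congr rfl fun i hi => ?_
            rw [if_neg (Finset.mem_range.1 hi).ne, ← ENNReal.rpow_mul]
            norm_num
  have hJ : ∀ i, 0 ≤ 9 * C * (jumpSum (2⁻¹ ^ i) 0 0 l + jumpSum (2⁻¹ ^ (i + 1)) 0 0 l) := fun i =>
    mul_nonneg (by positivity) (add_nonneg (jumpSum_nonneg _ _ _ _) (jumpSum_nonneg _ _ _ _))
  calc _ ≤ ∫⁻ x, (L + 1) * (ENNReal.ofReal (runMax 0 l ^ 2) + ∑ i ∈ Finset.range L, P i x) ∂μ :=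
        lintegral_mono hpt
    _ = (L + 1) * (ENNReal.ofReal (runMax 0 l ^ 2) * μ Set.univ +
          ∑ i ∈ Finset.range L, ∫⁻ x, P i x ∂μ) := by
        rw [lintegral_const_mul _ (by fun_prop), lintegral_add_left measurable_const,
          lintegral_finsetSum _ (fun i _ => hPm i), lintegral_const]
    _ ≤ (L + 1) * (ENNReal.ofReal (runMax 0 l ^ 2) * 1 + ∑ i ∈ Finset.range L, ENNReal.ofReal
          (9 * C * (jumpSum (2⁻¹ ^ i) 0 0 l + jumpSum (2⁻¹ ^ (i + 1)) 0 0 l))) := by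
        gcongr with i hi
        exact hPi i
    _ = _ := by
        rw [ENNReal.ofReal_mul (by positivity), ENNReal.ofReal_add (by positivity)
          (Finset.sum_nonneg fun i _ => hJ i), ENNReal.ofReal_sum_of_nonneg fun i _ => hJ i, mul_one]
        congr 1
        rw [ENNReal.ofReal_add (by positivity) (by norm_num)]
        simp

end Leaves

/-! ### Dyadic trees of blocks and sums over their leaves. -/

section Blocks

variable {H : Type*}

/-- The sum of `Φ b l` over the leaves `[b, b + 1)` of the binary tree of dyadic blocks below
`[a, a + 2 ^ K)`, where `l` lists the values of `A` along the path from the root to the leaf. -/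
def blockSum {Y : Type*} [Add Y] (A : ℕ → ℝ → H) : ℕ → ℝ → (ℝ → List H → Y) → Y
  | 0, a, Φ => Φ a [A 0 a]
  | K + 1, a, Φ => blockSum A K a (fun b l => Φ b (A (K + 1) a :: l)) +
      blockSum A K (a + 2 ^ K) (fun b l => Φ b (A (K + 1) a :: l))

/-- The values of `A` along the path from the root `[a, a + 2 ^ K)` to the leaf containing `x`. -/
def path (A : ℕ → ℝ → H) : ℕ → ℝ → ℝ → List H
  | 0, a, _ => [A 0 a]
  | K + 1, a, x => A (K + 1) a ::
      (open Classical in if x < a + 2 ^ K then path A K a x else path A K (a + 2 ^ K) x)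

lemma mem_path (A : ℕ → ℝ → H) {K k : ℕ} (hk : k ≤ K) {a x : ℝ} (h1 : a ≤ x) (h2 : x < a + 2 ^ K) :
    A k (a + 2 ^ k * ⌊(x - a) / 2 ^ k⌋) ∈ path A K a x := by
  have top : ∀ {K : ℕ} {a : ℝ}, a ≤ x → x < a + 2 ^ K →
      A K (a + 2 ^ K * ⌊(x - a) / 2 ^ K⌋) = A K a := by
    intro K a h1 h2
    have : ⌊(x - a) / 2 ^ K⌋ = 0 := by
      rw [Int.floor_eq_zero_iff]
      constructor
      · exact div_nonneg (by linarith) (by positivity)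
      · rw [div_lt_one (by positivity)]; linarith
    simp [this]
  induction K generalizing a with
  | zero =>
    obtain rfl : k = 0 := by omega
    rw [top h1 h2]; simp [path]
  | succ K ih =>
    rcases Nat.lt_or_ge K k with hk' | hk'
    · obtain rfl : k = K + 1 := by omega
      rw [top h1 h2]; simp [path]
    · simp only [path]
      refine List.mem_cons_of_mem _ ?_
      split_ifs with h
      · exact ih hk' h1 h
      · have := ih hk' (a := a + 2 ^ K) (not_lt.1 h) (by rw [pow_succ] at h2; linarith)
        convert this using 2
        obtain ⟨d, rfl⟩ := Nat.exists_eq_add_of_le hk'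
        -- The root moves by a multiple of 2^k, so the floor shifts by 2^d and the block itself is
        -- unchanged.
        have e : (x - (a + 2 ^ (k + d))) / 2 ^ k = (x - a) / 2 ^ k - ((2 ^ d : ℕ) : ℤ) := by
          push_cast; field_simp; ring
        rw [e, Int.floor_sub_intCast]
        push_cast; ring

/-- The path is constant on each leaf; this is what allows the large sieve to be applied there to
vectors independent of x. -/
lemma lintegral_path (A : ℕ → ℝ → H) (K : ℕ) (a : ℝ) (Ψ : ℝ → List H → ℝ≥0∞) :
    ∫⁻ x in Set.Ico a (a + 2 ^ K), Ψ x (path A K a x) =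
      blockSum A K a (fun b l => ∫⁻ x in Set.Ico b (b + 1), Ψ x l) := by
  induction K generalizing a Ψ with
  | zero => simp [blockSum, path]
  | succ K ih =>
    have hpos : (0 : ℝ) < 2 ^ K := by positivity
    have e : Set.Ico a (a + 2 ^ (K + 1)) =
        Set.Ico a (a + 2 ^ K) ∪ Set.Ico (a + 2 ^ K) (a + 2 ^ K + 2 ^ K) := by
      rw [Set.Ico_union_Ico_eq_Ico (by linarith) (by linarith), pow_succ]
      congr 1; ring
    rw [e, lintegral_union measurableSet_Ico]
    · simp only [blockSum]
      rw [← ih a (fun x l => Ψ x (A (K + 1) a :: l)),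
        ← ih (a + 2 ^ K) (fun x l => Ψ x (A (K + 1) a :: l))]
      congr 1
      · refine setLIntegral_congr_fun measurableSet_Ico fun x hx => ?_
        simp only [path, if_pos hx.2]
      · refine setLIntegral_congr_fun measurableSet_Ico fun x hx => ?_
        simp only [path, if_neg (not_lt.2 hx.1)]
    · rw [Set.disjoint_left]
      intro x hx hx'
      exact absurd hx.2 (not_lt.2 hx'.1)

lemma blockSum_mono {Y : Type*} [Add Y] [Preorder Y] [AddLeftMono Y] [AddRightMono Y]
    (A : ℕ → ℝ → H) (K : ℕ) (a : ℝ) {Φ Ψ : ℝ → List H → Y} (h : ∀ b l, Φ b l ≤ Ψ b l) :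
    blockSum A K a Φ ≤ blockSum A K a Ψ := by
  induction K generalizing a Φ Ψ with
  | zero => exact h _ _
  | succ K ih => exact add_le_add (ih _ fun _ _ => h _ _) (ih _ fun _ _ => h _ _)

lemma blockSum_add (A : ℕ → ℝ → H) (K : ℕ) (a : ℝ) (Φ Ψ : ℝ → List H → ℝ) :
    blockSum A K a (fun b l => Φ b l + Ψ b l) = blockSum A K a Φ + blockSum A K a Ψ := by
  induction K generalizing a Φ Ψ with
  | zero => rfl
  | succ K ih => simp only [blockSum, ih]; ring

lemma blockSum_const_mul (A : ℕ → ℝ → H) (K : ℕ) (a c : ℝ) (Φ : ℝ → List H → ℝ) :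
    blockSum A K a (fun b l => c * Φ b l) = c * blockSum A K a Φ := by
  induction K generalizing a Φ with
  | zero => rfl
  | succ K ih => simp only [blockSum, ih]; ring

lemma blockSum_const (A : ℕ → ℝ → H) (K : ℕ) (a c : ℝ) :
    blockSum A K a (fun _ _ => c) = 2 ^ K * c := by
  induction K generalizing a with
  | zero => simp [blockSum]
  | succ K ih => simp only [blockSum, ih]; ring

lemma blockSum_sum (A : ℕ → ℝ → H) (K : ℕ) (a : ℝ) {ι : Type*} (s : Finset ι)
    (Φ : ι → ℝ → List H → ℝ) :
    blockSum A K a (fun b l => ∑ i ∈ s, Φ i b l) = ∑ i ∈ s, blockSum A K a (Φ i) := by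
  classical
  induction s using Finset.induction_on with
  | empty => simp [blockSum_const]
  | insert i s hi ih => simp only [Finset.sum_insert hi, blockSum_add, ih]

lemma blockSum_ofReal (A : ℕ → ℝ → H) (K : ℕ) (a : ℝ) {Φ : ℝ → List H → ℝ}
    (h : ∀ b l, 0 ≤ Φ b l) :
    blockSum A K a (fun b l => ENNReal.ofReal (Φ b l)) = ENNReal.ofReal (blockSum A K a Φ) := by
  induction K generalizing a Φ with
  | zero => rfl
  | succ K ih =>
    simp only [blockSum]
    rw [ih _ fun _ _ => h _ _, ih _ fun _ _ => h _ _, ENNReal.ofReal_add]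
    all_goals
      refine le_trans ?_ (blockSum_mono (Φ := fun _ _ => (0 : ℝ)) A K _ fun _ _ => h _ _)
      simp [blockSum_const]

end Blocks

/-! ### Martingale estimates: jumps, Doob's inequality, and the maximal bound on one tree. -/

section Averages

variable {H : Type*} [NormedAddCommGroup H] [InnerProductSpace ℝ H]

/-- The average of `g` over `[a, a + 2 ^ k]`. -/
def avg (g : ℝ → H) (k : ℕ) (a : ℝ) : H := ((2 : ℝ) ^ k)⁻¹ • ∫ t in a..a + 2 ^ k, g t

lemma integral_eq_smul_avg (g : ℝ → H) (k : ℕ) (a : ℝ) :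
    ∫ t in a..a + 2 ^ k, g t = (2 : ℝ) ^ k • avg g k a := by
  rw [avg, smul_inv_smul₀ (by positivity)]

lemma avg_succ {g : ℝ → H} (hg : Continuous g) (k : ℕ) (a : ℝ) :
    avg g (k + 1) a = (2⁻¹ : ℝ) • (avg g k a + avg g k (a + 2 ^ k)) := by
  have : ∫ t in a..a + 2 ^ (k + 1), g t =
      (∫ t in a..a + 2 ^ k, g t) + ∫ t in a + 2 ^ k..a + 2 ^ k + 2 ^ k, g t := by
    rw [intervalIntegral.integral_add_adjacent_intervals (hg.intervalIntegrable _ _)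
      (hg.intervalIntegrable _ _)]
    congr 1; ring
  rw [avg, this, integral_eq_smul_avg, integral_eq_smul_avg, ← smul_add, smul_smul]
  congr 1
  field_simp; ring

/-- Pythagoras: over the block, g minus its average is orthogonal to constants. -/
lemma integral_norm_sub_sq [CompleteSpace H] {g : ℝ → H} (hg : Continuous g) (k : ℕ) (a : ℝ)
    (c : H) :
    ∫ t in a..a + 2 ^ k, ‖g t - c‖ ^ 2 =
      2 ^ k * ‖avg g k a - c‖ ^ 2 + ∫ t in a..a + 2 ^ k, ‖g t - avg g k a‖ ^ 2 := by
  set v := avg g k a with hv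
  have e : ∀ t, ‖g t - c‖ ^ 2 = ‖v - c‖ ^ 2 + 2 * inner ℝ (v - c) (g t - v) + ‖g t - v‖ ^ 2 := by
    intro t
    rw [← norm_add_sq_real]; congr 2; abel
  have hI : ∫ t in a..a + 2 ^ k, inner ℝ (v - c) (g t - v) = 0 := by
    have := (innerSL ℝ (v - c)).intervalIntegral_comp_comm (μ := volume)
      (f := fun t => g t - v) (a := a) (b := a + 2 ^ k)
      ((hg.sub continuous_const).intervalIntegrable _ _)
    simp only [innerSL_apply_apply] at this
    rw [this, intervalIntegral.integral_sub (hg.intervalIntegrable _ _) (by simp),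
      integral_eq_smul_avg, ← hv]
    simp
  have c1 : Continuous fun t => inner ℝ (v - c) (g t - v) := by fun_prop
  have c2 : Continuous fun t => ‖g t - v‖ ^ 2 := by fun_prop
  simp_rw [e]
  rw [intervalIntegral.integral_add (Continuous.intervalIntegrable (by fun_prop) _ _)
    (c2.intervalIntegrable _ _), intervalIntegral.integral_add (by simp)
    (Continuous.intervalIntegrable (by fun_prop) _ _), intervalIntegral.integral_const_mul, hI]
  simp

lemma integral_split {φ : ℝ → ℝ} (hφ : Continuous φ) (k : ℕ) (a : ℝ) :
    ∫ t in a..a + 2 ^ (k + 1), φ t =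
      (∫ t in a..a + 2 ^ k, φ t) + ∫ t in a + 2 ^ k..a + 2 ^ k + 2 ^ k, φ t := by
  rw [intervalIntegral.integral_add_adjacent_intervals (hφ.intervalIntegrable _ _)
    (hφ.intervalIntegrable _ _)]
  congr 1; ring

lemma sq_norm_anchor_sub_add_le [CompleteSpace H] {g : ℝ → H} (hg : Continuous g) (k : ℕ) (a : ℝ)
    (c : H) (δ M : ℝ) :
    2 ^ k * ‖anchor δ M (avg g k a) c - c‖ ^ 2 +
      ∫ t in a..a + 2 ^ k, ‖g t - anchor δ M (avg g k a) c‖ ^ 2 ≤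
      ∫ t in a..a + 2 ^ k, ‖g t - c‖ ^ 2 := by
  unfold anchor
  split_ifs
  · exact (integral_norm_sub_sq hg k a c).ge
  · simp

/-- Moving the anchor to a block average lowers the energy of g around it by the block length times
the squared jump, so the initial energy pays for all jumps down the tree, whatever the rule for
jumping. -/
lemma blockSum_jumpSum_le [CompleteSpace H] {g : ℝ → H} (hg : Continuous g) (K : ℕ) (a δ M : ℝ)
    (c : H) :
    blockSum (avg g) K a (fun _ l => jumpSum δ M c l) ≤ ∫ t in a..a + 2 ^ K, ‖g t - c‖ ^ 2 := by
  induction K generalizing a M c with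
  | zero =>
    have h := sq_norm_anchor_sub_add_le hg 0 a c δ (max M ‖avg g 0 a‖)
    have h' : 0 ≤ ∫ t in a..a + 2 ^ 0,
        ‖g t - anchor δ (max M ‖avg g 0 a‖) (avg g 0 a) c‖ ^ 2 :=
      intervalIntegral.integral_nonneg (by simp) fun _ _ => by positivity
    simp only [blockSum, jumpSum]
    linarith
  | succ K ih =>
    have h := sq_norm_anchor_sub_add_le hg (K + 1) a c δ (max M ‖avg g (K + 1) a‖)
    simp only [blockSum, jumpSum, blockSum_add, blockSum_const]
    set b := anchor δ (max M ‖avg g (K + 1) a‖) (avg g (K + 1) a) c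
    rw [integral_split (φ := fun t => ‖g t - b‖ ^ 2) (by fun_prop)] at h
    have h1 := ih a (max M ‖avg g (K + 1) a‖) b
    have h2 := ih (a + 2 ^ K) (max M ‖avg g (K + 1) a‖) b
    have e : (2 : ℝ) ^ (K + 1) * ‖b - c‖ ^ 2 = 2 ^ K * ‖b - c‖ ^ 2 + 2 ^ K * ‖b - c‖ ^ 2 := by ring
    linarith

/-- Doob's inequality by a potential, with M the running maximum and X the norm of the current
average. At a leaf, M² ≤ 2M² − 4MX + 4X² is (M − 2X)² ≥ 0. Going down, 2X ≤ X₁ + X₂, and updating M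
to max(M, X) does not increase 2M² − 4MX. -/
lemma blockSum_runMax_sq_le_potential [CompleteSpace H] {g : ℝ → H} (hg : Continuous g) (K : ℕ)
    (a M : ℝ) (hM : 0 ≤ M) :
    blockSum (avg g) K a (fun _ l => runMax M l ^ 2) ≤
      2 ^ K * (2 * max M ‖avg g K a‖ ^ 2 - 4 * max M ‖avg g K a‖ * ‖avg g K a‖) +
        4 * ∫ t in a..a + 2 ^ K, ‖g t‖ ^ 2 := by
  induction K generalizing a M with
  | zero =>
    have h := integral_norm_sub_sq hg 0 a 0
    have h' : 0 ≤ ∫ t in a..a + 2 ^ 0, ‖g t - avg g 0 a‖ ^ 2 :=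
      intervalIntegral.integral_nonneg (by simp) fun _ _ => by positivity
    simp only [sub_zero, pow_zero, one_mul] at h h'
    simp only [blockSum, runMax, pow_zero, one_mul]
    nlinarith [sq_nonneg (max M ‖avg g 0 a‖ - 2 * ‖avg g 0 a‖)]
  | succ K ih =>
    simp only [blockSum, runMax]
    set X := ‖avg g (K + 1) a‖ with hX
    set M' := max M X
    have hM' : 0 ≤ M' := le_max_of_le_left hM
    rw [integral_split (φ := fun t => ‖g t‖ ^ 2) (by fun_prop)]
    have h1 := ih a M' hM'
    have h2 := ih (a + 2 ^ K) M' hM'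
    set X₁ := ‖avg g K a‖ with hX1
    set X₂ := ‖avg g K (a + 2 ^ K)‖ with hX2
    have hXX : 2 * X ≤ X₁ + X₂ := by
      rw [hX, avg_succ hg, norm_smul]
      have := norm_add_le (avg g K a) (avg g K (a + 2 ^ K))
      norm_num
      linarith
    have step : ∀ Y, 2 * max M' Y ^ 2 - 4 * max M' Y * Y ≤ 2 * M' ^ 2 - 4 * M' * Y := by
      intro Y
      rcases le_total Y M' with h | h
      · rw [max_eq_left h]
      · rw [max_eq_right h]; nlinarith [sq_nonneg (Y - M')]
    have h3 : (2 : ℝ) ^ K * ((2 * max M' X₁ ^ 2 - 4 * max M' X₁ * X₁) +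
        (2 * max M' X₂ ^ 2 - 4 * max M' X₂ * X₂)) ≤ 2 ^ K * (2 * (2 * M' ^ 2 - 4 * M' * X)) := by
      gcongr
      nlinarith [step X₁, step X₂, mul_le_mul_of_nonneg_left hXX hM']
    rw [pow_succ (2 : ℝ) K]
    linarith

lemma blockSum_runMax_sq_le [CompleteSpace H] {g : ℝ → H} (hg : Continuous g) (K : ℕ) (a : ℝ) :
    blockSum (avg g) K a (fun _ l => runMax 0 l ^ 2) ≤ 4 * ∫ t in a..a + 2 ^ K, ‖g t‖ ^ 2 := by
  refine (blockSum_runMax_sq_le_potential hg K a 0 le_rfl).trans ?_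
  rw [max_eq_right (norm_nonneg _)]
  have : 0 ≤ (2 : ℝ) ^ K * ‖avg g K a‖ ^ 2 := by positivity
  nlinarith

/-- The maximal inequality for the dyadic averages over the blocks of one tree. -/
theorem lintegral_iSup_avg_sq_le [CompleteSpace H] {E : Type*} [NormedAddCommGroup E]
    {g : ℝ → H} (hg : Continuous g) (ℓ : ℝ → H →+ E) {B C : ℝ} (hB : 0 ≤ B) (hC : 0 ≤ C)
    (hℓm : ∀ v, Measurable fun x => ‖ℓ x v‖ₑ) (hℓ : ∀ x v, ‖ℓ x v‖ ≤ B * ‖v‖)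
    (hℓ2 : ∀ b v, ∫⁻ x in Set.Ico b (b + 1), ‖ℓ x v‖ₑ ^ 2 ≤ ENNReal.ofReal (C * ‖v‖ ^ 2))
    {L : ℕ} (hL : B ≤ 2 ^ L) (K : ℕ) (a : ℝ) :
    ∫⁻ x in Set.Ico a (a + 2 ^ K),
        (⨆ k ≤ K, ‖ℓ x (avg g k (a + 2 ^ k * ⌊(x - a) / 2 ^ k⌋))‖ₑ) ^ 2 ≤
      ENNReal.ofReal ((L + 1) * (4 + L * (18 * C)) * ∫ t in a..a + 2 ^ K, ‖g t‖ ^ 2) := by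
  calc _ ≤ ∫⁻ x in Set.Ico a (a + 2 ^ K), (⨆ v ∈ path (avg g) K a x, ‖ℓ x v‖ₑ) ^ 2 := by
        refine setLIntegral_mono' measurableSet_Ico fun x hx => ?_
        gcongr
        refine iSup₂_le fun k hk => ?_
        exact le_iSup₂ (f := fun v (_ : v ∈ path (avg g) K a x) => ‖ℓ x v‖ₑ) _
          (mem_path (avg g) hk hx.1 hx.2)
    _ = blockSum (avg g) K a (fun b l => ∫⁻ x in Set.Ico b (b + 1), (⨆ v ∈ l, ‖ℓ x v‖ₑ) ^ 2) :=
        lintegral_path (avg g) K a fun x l => (⨆ v ∈ l, ‖ℓ x v‖ₑ) ^ 2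
    _ ≤ blockSum (avg g) K a (fun _ l => ENNReal.ofReal ((L + 1) * (runMax 0 l ^ 2 +
          ∑ i ∈ Finset.range L,
            9 * C * (jumpSum (2⁻¹ ^ i) 0 0 l + jumpSum (2⁻¹ ^ (i + 1)) 0 0 l)))) := by
        refine blockSum_mono _ _ _ fun b l => ?_
        exact lintegral_iSup_mem_sq_le (by simp) ℓ hB hC hℓm hℓ (hℓ2 b) hL l
    _ = ENNReal.ofReal (blockSum (avg g) K a (fun _ l => (L + 1) * (runMax 0 l ^ 2 +
          ∑ i ∈ Finset.range L,
            9 * C * (jumpSum (2⁻¹ ^ i) 0 0 l + jumpSum (2⁻¹ ^ (i + 1)) 0 0 l)))) := by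
        refine blockSum_ofReal _ _ _ fun b l => mul_nonneg (by positivity) (add_nonneg
          (by positivity) (Finset.sum_nonneg fun i _ => mul_nonneg (by positivity)
            (add_nonneg (jumpSum_nonneg _ _ _ _) (jumpSum_nonneg _ _ _ _))))
    _ ≤ _ := by
        refine ENNReal.ofReal_le_ofReal ?_
        rw [blockSum_const_mul, blockSum_add, blockSum_sum, mul_assoc]
        refine mul_le_mul_of_nonneg_left ?_ (by positivity)
        rw [add_mul]
        refine add_le_add (blockSum_runMax_sq_le hg K a) ?_
        rw [mul_assoc]
        refine (Finset.sum_le_card_nsmul _ _ (18 * C * ∫ t in a..a + 2 ^ K, ‖g t‖ ^ 2)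
          fun i _ => ?_).trans (by simp)
        rw [blockSum_const_mul, blockSum_add]
        have h1 := blockSum_jumpSum_le hg K a (2⁻¹ ^ i) 0 0
        have h2 := blockSum_jumpSum_le hg K a (2⁻¹ ^ (i + 1)) 0 0
        simp only [sub_zero] at h1 h2
        nlinarith

end Averages

/-! ### Plancherel, orthogonality of separated bands, and the large sieve. -/

section Fourier

/-- The character `e(t) = exp (2πit)`. -/
def ee (t : ℝ) : ℂ := Complex.exp (2 * Real.pi * Complex.I * t)

lemma ee_add (s t : ℝ) : ee (s + t) = ee s * ee t := by
  rw [ee, ee, ee, ← Complex.exp_add]; push_cast; ring_nf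

@[simp]
lemma norm_ee (t : ℝ) : ‖ee t‖ = 1 := by
  rw [ee, show (2 * Real.pi * Complex.I * t : ℂ) = ((2 * Real.pi * t : ℝ) : ℂ) * Complex.I by
    push_cast; ring, Complex.norm_exp_ofReal_mul_I]

lemma contDiff_ee {n : WithTop ℕ∞} : ContDiff ℝ n ee := by
  unfold ee
  refine Complex.contDiff_exp.comp (contDiff_const.mul Complex.ofRealCLM.contDiff)

@[fun_prop]
lemma continuous_ee : Continuous ee := contDiff_ee (n := 0).continuous

lemma fourierInv_eq_ee (R : ℝ → ℂ) (x : ℝ) : 𝓕⁻ R x = ∫ ξ, ee (ξ * x) * R ξ := by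
  rw [Real.fourierInv_eq']
  refine integral_congr_ae (.of_forall fun ξ => ?_)
  simp only [ee, smul_eq_mul, RCLike.inner_apply, conj_trivial]
  push_cast; ring_nf

lemma fourier_eq_ee (R : ℝ → ℂ) (x : ℝ) : 𝓕 R x = ∫ ξ, ee (-(ξ * x)) * R ξ := by
  rw [Real.fourier_eq']
  refine integral_congr_ae (.of_forall fun ξ => ?_)
  simp only [ee, smul_eq_mul, RCLike.inner_apply, conj_trivial]
  push_cast; ring_nf

lemma continuous_fourierInv {R : ℝ → ℂ} (hR : Integrable R) : Continuous (𝓕⁻ R) := by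
  simp only [Real.fourierInv_eq_fourier_comp_neg]
  exact VectorFourier.fourierIntegral_continuous Real.continuous_fourierChar
    (by exact continuous_inner) hR.comp_neg

lemma integral_smul_fourierInv {R : ℝ → ℂ} (hR : Integrable R) (φ : 𝓢(ℝ, ℂ)) :
    ∫ x, φ x * 𝓕⁻ R x = ∫ ξ, (𝓕⁻ φ : 𝓢(ℝ, ℂ)) ξ * R ξ := by
  have := VectorFourier.integral_fourierIntegral_smul_eq_flip (μ := volume) (ν := volume)
    (L := -innerₗ ℝ) (f := (φ : ℝ → ℂ)) (g := R) Real.continuous_fourierChar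
    (by simp only [LinearMap.neg_apply, innerₗ_apply_apply]; exact continuous_inner.neg)
    φ.integrable hR
  have e : (-innerₗ ℝ).flip = -innerₗ ℝ := by
    ext; simp
  rw [e] at this
  rw [SchwartzMap.fourierInv_coe]
  exact this.symm

/-- Plancherel's theorem for functions in `L¹ ∩ L²`. -/
theorem eLpNorm_fourierInv {R : ℝ → ℂ} (h1 : Integrable R) (h2 : MemLp R 2) :
    eLpNorm (𝓕⁻ R) 2 volume = eLpNorm R 2 volume := by
  set S : Lp ℂ 2 (volume : Measure ℝ) := 𝓕⁻ (h2.toLp R)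
  have hae : ∀ᵐ x, S x = 𝓕⁻ R x := by
    -- The L² inverse transform is identified with the integral one by testing both against smooth
    -- compactly supported functions.
    refine ae_eq_of_integral_contDiff_smul_eq ((Lp.memLp S).locallyIntegrable (by norm_num))
      (continuous_fourierInv h1).locallyIntegrable fun g hg hgc => ?_
    set φ : 𝓢(ℝ, ℂ) := HasCompactSupport.toSchwartzMap (f := fun x => (g x : ℂ))
      (hgc.comp_left Complex.ofReal_zero) (Complex.ofRealCLM.contDiff.comp hg)
    have hφx : ∀ x, φ x = (g x : ℂ) := fun _ => rfl
    have e1 := congrArg (fun T => T φ) (Lp.fourierInv_toTemperedDistribution_eq (h2.toLp R))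
    simp only [TemperedDistribution.fourierInv_apply, Lp.toTemperedDistribution_apply,
      smul_eq_mul] at e1
    have e2 := integral_smul_fourierInv h1 φ
    have e3 : ∫ ξ, (𝓕⁻ φ : 𝓢(ℝ, ℂ)) ξ * (h2.toLp R : ℝ → ℂ) ξ =
        ∫ ξ, (𝓕⁻ φ : 𝓢(ℝ, ℂ)) ξ * R ξ :=
      integral_congr_ae (h2.coeFn_toLp.mono fun x hx => by simp only [hx])
    calc ∫ x, g x • S x = ∫ x, φ x * S x := by simp [hφx]
      _ = ∫ x, φ x * 𝓕⁻ R x := by rw [← e1, e3, e2]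
      _ = _ := by simp [hφx]
  rw [← eLpNorm_congr_ae hae]
  have h3 : ‖S‖ = ‖h2.toLp R‖ := (Lp.fourierTransformₗᵢ ℝ ℂ).symm.norm_map _
  have h4 : ‖S‖ₑ = ‖h2.toLp R‖ₑ := by rw [← ofReal_norm, ← ofReal_norm, h3]
  rwa [Lp.enorm_def, Lp.enorm_toLp] at h4

lemma integral_mul_fourier_toLp {f : ℝ → ℂ} (hf : MemLp f 2) (ψ : 𝓢(ℝ, ℂ)) :
    ∫ ξ, ψ ξ * (𝓕 (hf.toLp f) : Lp ℂ 2 (volume : Measure ℝ)) ξ = ∫ y, 𝓕 (ψ : ℝ → ℂ) y * f y := by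
  have e1 := congrArg (fun T => T ψ) (Lp.fourier_toTemperedDistribution_eq (hf.toLp f))
  simp only [TemperedDistribution.fourier_apply, Lp.toTemperedDistribution_apply,
    smul_eq_mul] at e1
  rw [← e1]
  refine integral_congr_ae (hf.coeFn_toLp.mono fun x hx => ?_)
  simp only [hx, SchwartzMap.fourier_coe]

lemma eLpNorm_fourier_toLp {f : ℝ → ℂ} (hf : MemLp f 2) :
    eLpNorm (𝓕 (hf.toLp f) : Lp ℂ 2 (volume : Measure ℝ)) 2 volume = eLpNorm f 2 volume := by
  have h3 := Lp.norm_fourier_eq (hf.toLp f)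
  have h4 : ‖(𝓕 (hf.toLp f) : Lp ℂ 2 (volume : Measure ℝ))‖ₑ = ‖hf.toLp f‖ₑ := by
    rw [← ofReal_norm, ← ofReal_norm, h3]
  rwa [Lp.enorm_def, Lp.enorm_toLp] at h4

lemma eLpNorm_two_sq {α E : Type*} [MeasurableSpace α] [TopologicalSpace E] [ContinuousENorm E]
    (μ : Measure α) (f : α → E) : eLpNorm f 2 μ ^ 2 = ∫⁻ x, ‖f x‖ₑ ^ 2 ∂μ := by
  have := eLpNorm_nnreal_pow_eq_lintegral (f := f) (μ := μ) (p := 2) (by norm_num)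
  simpa using this

lemma lintegral_fourierInv_sq {R : ℝ → ℂ} (h1 : Integrable R) (h2 : MemLp R 2) :
    ∫⁻ x, ‖𝓕⁻ R x‖ₑ ^ 2 = ∫⁻ ξ, ‖R ξ‖ₑ ^ 2 := by
  rw [← eLpNorm_two_sq, ← eLpNorm_two_sq, eLpNorm_fourierInv h1 h2]

lemma ee_mul_fourierInv (c : ℝ → ℂ) (θ x : ℝ) :
    ee (θ * x) * 𝓕⁻ c x = 𝓕⁻ (fun ξ => c (ξ - θ)) x := by
  rw [fourierInv_eq_ee, fourierInv_eq_ee, ← integral_sub_right_eq_self _ θ, ← integral_const_mul]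
  refine integral_congr_ae (.of_forall fun ξ => ?_)
  simp only
  rw [← mul_assoc, ← ee_add]
  ring_nf

lemma enorm_sum_sq_of_pairwise {ι : Type*} [Fintype ι] (c : ι → ℂ)
    (h : ∀ i j, i ≠ j → c i = 0 ∨ c j = 0) : ‖∑ i, c i‖ₑ ^ 2 = ∑ i, ‖c i‖ₑ ^ 2 := by
  by_cases h0 : ∀ i, c i = 0
  · simp [h0]
  · push Not at h0
    obtain ⟨i, hi⟩ := h0
    have hj : ∀ j, j ≠ i → c j = 0 := fun j hj => (h j i hj).resolve_right hi
    rw [Finset.sum_eq_single i (fun j _ hji => hj j hji) (by simp),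
      Finset.sum_eq_single i (fun j _ hji => by simp [hj j hji]) (by simp)]

lemma OneSeparated.half_lt_abs {N : ℕ} {θ : Fin N → ℝ} (hθ : OneSeparated θ) (ξ : ℝ)
    {i j : Fin N} (hij : i ≠ j) : 1 / 2 < |ξ - θ i| ∨ 1 / 2 < |ξ - θ j| := by
  by_contra! h
  have h1 := hθ i j hij
  have h2 : |θ i - θ j| ≤ |ξ - θ j| + |ξ - θ i| := by
    rw [show θ i - θ j = (ξ - θ j) - (ξ - θ i) by ring]; exact abs_sub _ _
  linarith [h.1, h.2]

/-- Orthogonality of the modulations of functions with spectrum in `[-1/2, 1/2]`. -/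
theorem lintegral_sum_modulate_sq {N : ℕ} {θ : Fin N → ℝ} (hθ : OneSeparated θ)
    {c : Fin N → ℝ → ℂ} (h1 : ∀ n, Integrable (c n)) (h2 : ∀ n, MemLp (c n) 2)
    (hc : ∀ n ξ, 1 / 2 < |ξ| → c n ξ = 0) :
    ∫⁻ x, ‖∑ n, ee (θ n * x) * 𝓕⁻ (c n) x‖ₑ ^ 2 = ∑ n, ∫⁻ ξ, ‖c n ξ‖ₑ ^ 2 := by
  have h1' : ∀ n, Integrable fun ξ => c n (ξ - θ n) := fun n => (h1 n).comp_sub_right (θ n)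
  have h2' : ∀ n, MemLp (fun ξ => c n (ξ - θ n)) 2 := fun n =>
    (h2 n).comp_measurePreserving (measurePreserving_sub_right volume (θ n))
  have e : ∀ x, ∑ n, ee (θ n * x) * 𝓕⁻ (c n) x = 𝓕⁻ (fun ξ => ∑ n, c n (ξ - θ n)) x := by
    intro x
    simp_rw [ee_mul_fourierInv]
    simp_rw [fourierInv_eq_ee, Finset.mul_sum]
    rw [integral_finsetSum]
    intro n _
    refine (h1' n).bdd_mul (c := 1) (by fun_prop) (.of_forall fun ξ => by simp)
  simp_rw [e]
  rw [lintegral_fourierInv_sq (integrable_finsetSum _ fun n _ => h1' n)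
    (memLp_finsetSum _ fun n _ => h2' n)]
  -- At each frequency at most one summand survives: the translates of [-1/2, 1/2] by the θ_n are
  -- disjoint.
  have hp : ∀ ξ, ‖∑ n, c n (ξ - θ n)‖ₑ ^ 2 = ∑ n, ‖c n (ξ - θ n)‖ₑ ^ 2 := by
    intro ξ
    exact enorm_sum_sq_of_pairwise _ fun i j hij => (hθ.half_lt_abs ξ hij).imp (hc _ _) (hc _ _)
  simp_rw [hp]
  rw [lintegral_finsetSum' _ fun n _ => (h1' n).aestronglyMeasurable.enorm.pow_const 2]
  exact Finset.sum_congr rfl fun n _ =>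
    lintegral_sub_right_eq_self (fun ξ => ‖c n ξ‖ₑ ^ 2) (θ n)

lemma norm_ee_sub_one_le (t : ℝ) : ‖ee t - 1‖ ≤ 2 * Real.pi * |t| := by
  have := Real.norm_exp_I_mul_ofReal_sub_one_le (x := 2 * Real.pi * t)
  rw [Real.norm_eq_abs, abs_mul, abs_of_pos Real.two_pi_pos] at this
  refine le_trans (le_of_eq ?_) this
  rw [ee]; push_cast; ring_nf

lemma setLIntegral_Ico_add (φ : ℝ → ℝ≥0∞) (b T : ℝ) :
    ∫⁻ x in Set.Ico b (b + T), φ x = ∫⁻ x in Set.Ico 0 T, φ (x + b) := by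
  rw [← lintegral_indicator measurableSet_Ico, ← lintegral_indicator measurableSet_Ico,
    ← lintegral_add_right_eq_self _ b]
  refine lintegral_congr fun x => ?_
  by_cases h : x ∈ Set.Ico (0 : ℝ) T
  · rw [Set.indicator_of_mem h, Set.indicator_of_mem]
    exact ⟨by linarith [h.1], by linarith [h.2]⟩
  · rw [Set.indicator_of_notMem h, Set.indicator_of_notMem]
    exact fun hx => h ⟨by linarith [hx.1], by linarith [hx.2]⟩

/-- The large sieve inequality on an interval of length one. -/
theorem lintegral_exponential_sum_sq_le {N : ℕ} {θ : Fin N → ℝ} (hθ : OneSeparated θ)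
    (v : Fin N → ℂ) (b : ℝ) :
    ∫⁻ x in Set.Ico b (b + 1), ‖∑ n, ee (θ n * x) * v n‖ₑ ^ 2 ≤ 32 * ∑ n, ‖v n‖ₑ ^ 2 := by
  -- The sum is weighted by s, the inverse transform of the indicator of `I`, so that orthogonality
  -- on ℝ applies. As |I| = 1/8, on [0, 1) one has |s| ≥ (1/8)(1 − π/8) ≥ 1/16, and the constant is
  -- 16² · 1/8 = 32.
  set I : Set ℝ := Set.Icc (-1 / 16) (1 / 16) with hI
  set c : Fin N → ℝ → ℂ := fun n => I.indicator fun _ => ee (θ n * b) * v n with hc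
  have hIm : MeasurableSet I := measurableSet_Icc
  have hIv : volume I = ENNReal.ofReal (1 / 8) := by rw [hI, Real.volume_Icc]; norm_num
  have key := lintegral_sum_modulate_sq hθ (c := c)
    (fun n => (integrable_indicator_iff hIm).2 (integrableOn_const (by simp [hIv])))
    (fun n => memLp_indicator_const 2 hIm _ (Or.inr (by simp [hIv]))) (by
      intro n ξ hξ
      refine Set.indicator_of_notMem (fun h => ?_) _
      have : |ξ| ≤ 1 / 16 := abs_le.2 ⟨by linarith [h.1], h.2⟩
      linarith)
  set s : ℝ → ℂ := fun x => ∫ ξ in I, ee (ξ * x) with hs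
  have hF : ∀ n x, 𝓕⁻ (c n) x = s x * (ee (θ n * b) * v n) := by
    intro n x
    rw [fourierInv_eq_ee, hs]
    simp only [hc]
    rw [← integral_mul_const, ← integral_indicator hIm]
    refine integral_congr_ae (.of_forall fun ξ => ?_)
    by_cases h : ξ ∈ I <;> simp [h]
  have hs_lower : ∀ x ∈ Set.Ico (0 : ℝ) 1, 1 / 16 ≤ ‖s x‖ := by
    intro x hx
    have h1 : ‖∫ ξ in I, (ee (ξ * x) - 1)‖ ≤ 2 * Real.pi * (1 / 16) * volume.real I := by
      refine norm_setIntegral_le_of_norm_le_const (by simp [hIv]) fun ξ hξ => ?_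
      refine (norm_ee_sub_one_le _).trans ?_
      have : |ξ * x| ≤ 1 / 16 * 1 := by
        rw [abs_mul]
        refine mul_le_mul (abs_le.2 ⟨by linarith [hξ.1], hξ.2⟩) ?_ (abs_nonneg _) (by norm_num)
        rw [abs_of_nonneg hx.1]; exact hx.2.le
      have := Real.pi_pos
      gcongr
      linarith
    have hr : volume.real I = 1 / 8 := by rw [measureReal_def, hIv]; norm_num
    have h0 : IntegrableOn (fun ξ => ee (ξ * x)) I := Continuous.integrableOn_Icc (by fun_prop)
    rw [integral_sub h0.integrable (integrable_const 1), hr] at h1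
    have h2 : ∫ ξ in I, (1 : ℂ) = 1 / 8 := by
      rw [setIntegral_const, hr]; norm_num
    rw [h2] at h1
    have h3 : ‖(1 / 8 : ℂ)‖ = 1 / 8 := by norm_num
    have h4 := norm_sub_norm_le (1 / 8 : ℂ) (s x)
    rw [norm_sub_rev, h3] at h4
    have := Real.pi_lt_d2
    have h5 : ‖s x - 1 / 8‖ ≤ 2 * Real.pi * (1 / 16) * (1 / 8) := h1
    linarith
  have hsum : ∑ n, ∫⁻ ξ, ‖c n ξ‖ₑ ^ 2 = ENNReal.ofReal (1 / 8) * ∑ n, ‖v n‖ₑ ^ 2 := by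
    rw [Finset.mul_sum]
    refine Finset.sum_congr rfl fun n _ => ?_
    have : ∀ ξ, ‖c n ξ‖ₑ ^ 2 = I.indicator (fun _ => ‖v n‖ₑ ^ 2) ξ := by
      intro ξ
      by_cases h : ξ ∈ I
      · simp only [hc, Set.indicator_of_mem h, enorm_mul]
        rw [← ofReal_norm (ee _), norm_ee]; simp
      · simp [hc, h]
    simp_rw [this]
    rw [lintegral_indicator hIm, setLIntegral_const, hIv, mul_comm]
  calc ∫⁻ x in Set.Ico b (b + 1), ‖∑ n, ee (θ n * x) * v n‖ₑ ^ 2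
      = ∫⁻ x in Set.Ico 0 1, ‖∑ n, ee (θ n * (x + b)) * v n‖ₑ ^ 2 :=
        setLIntegral_Ico_add _ b 1
    _ ≤ ∫⁻ x in Set.Ico 0 1, 256 * ‖∑ n, ee (θ n * x) * 𝓕⁻ (c n) x‖ₑ ^ 2 := by
        refine setLIntegral_mono' measurableSet_Ico fun x hx => ?_
        have e : ∑ n, ee (θ n * x) * 𝓕⁻ (c n) x = s x * ∑ n, ee (θ n * (x + b)) * v n := by
          rw [Finset.mul_sum]
          refine Finset.sum_congr rfl fun n _ => ?_
          rw [hF, mul_add, ee_add]; ring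
        rw [e, enorm_mul, mul_pow, ← mul_assoc]
        refine le_mul_of_one_le_left (by positivity) ?_
        rw [← ofReal_norm, ← ENNReal.ofReal_pow (norm_nonneg _),
          show (256 : ℝ≥0∞) = ENNReal.ofReal 256 by norm_num, ← ENNReal.ofReal_mul (by norm_num),
          ← ENNReal.ofReal_one]
        refine ENNReal.ofReal_le_ofReal ?_
        have := pow_le_pow_left₀ (by norm_num) (hs_lower x hx) 2
        linarith
    _ ≤ ∫⁻ x, 256 * ‖∑ n, ee (θ n * x) * 𝓕⁻ (c n) x‖ₑ ^ 2 := setLIntegral_le_lintegral _ _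
    _ = 256 * (ENNReal.ofReal (1 / 8) * ∑ n, ‖v n‖ₑ ^ 2) := by
        rw [lintegral_const_mul' _ _ (by norm_num), key, hsum]
    _ = _ := by
        rw [← mul_assoc, show (256 : ℝ≥0∞) = ENNReal.ofReal 256 by norm_num,
          ← ENNReal.ofReal_mul (by norm_num)]
        norm_num

end Fourier

/-! ### Multipliers of the averages and their distance from χ̂(2^k ξ). -/

section Multipliers

/-- The multiplier of the one-sided average over an interval of length `2 ^ k`. -/
def avgMult (k : ℕ) (ξ : ℝ) : ℂ := ((2 : ℝ) ^ k)⁻¹ • ∫ s in (0 : ℝ)..2 ^ k, ee (s * ξ)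

lemma continuous_avgMult (k : ℕ) : Continuous (avgMult k) := by
  have h : Continuous fun ξ => ∫ s in (0 : ℝ)..2 ^ k, ee (s * ξ) :=
    intervalIntegral.continuous_parametric_intervalIntegral_of_continuous' (by fun_prop) _ _
  exact h.const_smul (((2 : ℝ) ^ k)⁻¹)

lemma norm_inv_smul_integral_le {φ : ℝ → ℂ} {C : ℝ} (k : ℕ)
    (h : ∀ s ∈ Set.uIoc (0 : ℝ) (2 ^ k), ‖φ s‖ ≤ C) :
    ‖((2 : ℝ) ^ k)⁻¹ • ∫ s in (0 : ℝ)..2 ^ k, φ s‖ ≤ C := by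
  have h1 := intervalIntegral.norm_integral_le_of_norm_le_const h
  rw [sub_zero, abs_of_pos (by positivity)] at h1
  rw [norm_smul, norm_inv, Real.norm_of_nonneg (by positivity), inv_mul_le_iff₀ (by positivity)]
  linarith

lemma norm_avgMult_le_one (k : ℕ) (ξ : ℝ) : ‖avgMult k ξ‖ ≤ 1 :=
  norm_inv_smul_integral_le k fun s _ => by simp

lemma norm_avgMult_sub_one_le (k : ℕ) (ξ : ℝ) :
    ‖avgMult k ξ - 1‖ ≤ 2 * Real.pi * |2 ^ k * ξ| := by
  have e : avgMult k ξ - 1 = ((2 : ℝ) ^ k)⁻¹ • ∫ s in (0 : ℝ)..2 ^ k, (ee (s * ξ) - 1) := by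
    rw [intervalIntegral.integral_sub (Continuous.intervalIntegrable (by fun_prop) _ _)
      (by simp), smul_sub, avgMult]
    simp
  rw [e]
  refine norm_inv_smul_integral_le k fun s hs => (norm_ee_sub_one_le _).trans ?_
  rw [Set.uIoc_of_le (by positivity)] at hs
  have := Real.pi_pos
  rw [abs_mul, abs_mul, abs_of_pos hs.1, abs_of_pos (by positivity : (0 : ℝ) < 2 ^ k)]
  gcongr
  exact hs.2

lemma norm_avgMult_mul_le (k : ℕ) (ξ : ℝ) : ‖avgMult k ξ‖ * |2 ^ k * ξ| ≤ 1 / 2 := by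
  rcases eq_or_ne ξ 0 with rfl | hξ
  · simp
  have hc : (2 * Real.pi * Complex.I * ξ : ℂ) ≠ 0 := by
    simp [Real.pi_ne_zero, hξ]
  have e : ∫ s in (0 : ℝ)..2 ^ k, ee (s * ξ) =
      (ee (2 ^ k * ξ) - 1) / (2 * Real.pi * Complex.I * ξ) := by
    have := integral_exp_mul_complex (a := 0) (b := 2 ^ k) hc
    have e1 : ∀ s : ℝ, ee (s * ξ) = Complex.exp (2 * Real.pi * Complex.I * ξ * s) := by
      intro s; rw [ee]; push_cast; ring_nf
    simp_rw [e1]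
    rw [this]
    simp
  have h2 : ‖ee (2 ^ k * ξ) - 1‖ ≤ 2 := by
    refine (norm_sub_le _ _).trans ?_
    rw [norm_ee]; norm_num
  rw [avgMult, e, norm_smul, norm_div, abs_mul, norm_inv, Real.norm_of_nonneg (by positivity),
    abs_of_pos (by positivity : (0 : ℝ) < 2 ^ k)]
  have h3 : ‖(2 * Real.pi * Complex.I * ξ : ℂ)‖ = 2 * Real.pi * |ξ| := by
    simp [abs_of_pos Real.pi_pos]
  rw [h3]
  have hx : 0 < |ξ| := abs_pos.2 hξ
  have hpi := Real.pi_gt_three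
  rw [show ((2 : ℝ) ^ k)⁻¹ * (‖ee (2 ^ k * ξ) - 1‖ / (2 * Real.pi * |ξ|)) * (2 ^ k * |ξ|) =
    ‖ee (2 ^ k * ξ) - 1‖ / (2 * Real.pi) by field_simp]
  rw [div_le_iff₀ (by positivity)]
  linarith

lemma integrable_mul_of_bounded {G m : ℝ → ℂ} (hG : Integrable G) (hm : Continuous m) {C : ℝ}
    (hb : ∀ ξ, ‖m ξ‖ ≤ C) : Integrable fun ξ => m ξ * G ξ :=
  hG.bdd_mul hm.aestronglyMeasurable (.of_forall hb)

/-- The sign σ = 1 serves the average over a block, σ = -1 the average over the position of the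
block; `tentAvg` composes the two. -/
lemma inv_smul_integral_fourierInv {G : ℝ → ℂ} (hG : Integrable G) (k : ℕ) (σ x : ℝ) :
    ((2 : ℝ) ^ k)⁻¹ • ∫ s in (0 : ℝ)..2 ^ k, 𝓕⁻ G (x + σ * s) =
      𝓕⁻ (fun ξ => avgMult k (σ * ξ) * G ξ) x := by
  simp_rw [fourierInv_eq_ee]
  rw [intervalIntegral.integral_of_le (by positivity), integral_integral_swap]
  · rw [← integral_smul]
    refine integral_congr_ae (.of_forall fun ξ => ?_)
    simp only [avgMult]
    rw [← intervalIntegral.integral_of_le (by positivity), intervalIntegral.integral_mul_const]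
    have : ∀ s, ee (ξ * (x + σ * s)) = ee (ξ * x) * ee (s * (σ * ξ)) := by
      intro s; rw [← ee_add]; ring_nf
    simp_rw [this]
    rw [intervalIntegral.integral_const_mul]
    simp only [Complex.real_smul]
    ring
  · have h1 : Integrable (fun p : ℝ × ℝ => (1 : ℂ) * G p.2)
        ((volume.restrict (Set.Ioc 0 (2 ^ k))).prod volume) :=
      Integrable.mul_prod (f := fun _ : ℝ => (1 : ℂ)) (integrable_const 1) hG
    simp only [one_mul] at h1
    refine h1.bdd_mul (f := fun p : ℝ × ℝ => ee (p.2 * (x + σ * p.1))) (c := 1) ?_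
      (.of_forall fun p => by simp)
    exact Continuous.aestronglyMeasurable (by fun_prop)

/-- The average of the dyadic averages over all blocks of length `2 ^ k` containing `x`. -/
def tentAvg (h : ℝ → ℂ) (k : ℕ) (x : ℝ) : ℂ :=
  ((2 : ℝ) ^ k)⁻¹ • ∫ y in (0 : ℝ)..2 ^ k, avg h k (x - y)

lemma avg_fourierInv {G : ℝ → ℂ} (hG : Integrable G) (k : ℕ) (a : ℝ) :
    avg (𝓕⁻ G) k a = 𝓕⁻ (fun ξ => avgMult k ξ * G ξ) a := by
  have := inv_smul_integral_fourierInv hG k 1 a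
  simp only [one_mul] at this
  rw [← this, avg]
  congr 1
  rw [intervalIntegral.integral_comp_add_left (fun t => 𝓕⁻ G t)]
  simp

lemma tentAvg_fourierInv {G : ℝ → ℂ} (hG : Integrable G) (k : ℕ) (x : ℝ) :
    tentAvg (𝓕⁻ G) k x = 𝓕⁻ (fun ξ => avgMult k (-ξ) * avgMult k ξ * G ξ) x := by
  have h1 := integrable_mul_of_bounded hG (continuous_avgMult k) (norm_avgMult_le_one k)
  have := inv_smul_integral_fourierInv h1 k (-1) x
  simp only [neg_one_mul, ← sub_eq_add_neg, ← mul_assoc] at this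
  rw [← this, tentAvg]
  congr 1
  refine intervalIntegral.integral_congr fun y _ => ?_
  exact avg_fourierInv hG k _

lemma IsAdmissible.eq_one {χ : 𝓢(ℝ, ℂ)} (hχ : IsAdmissible χ) {ξ : ℝ} (h : |ξ| ≤ 1 / 4) :
    𝓕 (χ : ℝ → ℂ) ξ = 1 := by
  obtain ⟨h1, h2, h3⟩ := hχ ξ
  obtain ⟨h4, h5⟩ := abs_le.1 h
  rw [Set.indicator_of_mem (Set.mem_Icc.2 ⟨by linarith, by linarith⟩)] at h2 h3
  exact Complex.ext (le_antisymm h3 h2) h1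

lemma IsAdmissible.eq_zero {χ : 𝓢(ℝ, ℂ)} (hχ : IsAdmissible χ) {ξ : ℝ} (h : 1 / 2 < |ξ|) :
    𝓕 (χ : ℝ → ℂ) ξ = 0 := by
  obtain ⟨h1, h2, h3⟩ := hχ ξ
  rw [Set.indicator_of_notMem
    fun h' => absurd (abs_le.2 ⟨by linarith [h'.1], h'.2⟩) (not_le.2 h)] at h3
  have h4 := (Set.indicator_nonneg (fun _ _ => zero_le_one) ξ).trans h2
  exact Complex.ext (le_antisymm h3 h4) h1

lemma IsAdmissible.norm_le_one {χ : 𝓢(ℝ, ℂ)} (hχ : IsAdmissible χ) (ξ : ℝ) :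
    ‖𝓕 (χ : ℝ → ℂ) ξ‖ ≤ 1 := by
  obtain ⟨h1, h2, h3⟩ := hχ ξ
  have h4 := (Set.indicator_nonneg (fun _ _ => zero_le_one) ξ).trans h2
  have h5 := h3.trans (Set.indicator_le_self' (fun _ _ => zero_le_one) ξ)
  have e : 𝓕 (χ : ℝ → ℂ) ξ = ((𝓕 (χ : ℝ → ℂ) ξ).re : ℂ) := Complex.ext rfl (by simpa using h1)
  rw [e, Complex.norm_real, Real.norm_of_nonneg h4]
  exact h5

/-- The difference of the multipliers of `χ_k * ·` and of `tentAvg`. -/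
def diffMult (χ : 𝓢(ℝ, ℂ)) (k : ℕ) (ξ : ℝ) : ℂ :=
  𝓕 (χ : ℝ → ℂ) (2 ^ k * ξ) - avgMult k (-ξ) * avgMult k ξ

lemma continuous_fourier_schwartz (χ : 𝓢(ℝ, ℂ)) : Continuous (𝓕 (χ : ℝ → ℂ)) := by
  rw [← SchwartzMap.fourier_coe]; exact (𝓕 χ : 𝓢(ℝ, ℂ)).continuous

lemma continuous_diffMult (χ : 𝓢(ℝ, ℂ)) (k : ℕ) : Continuous (diffMult χ k) := by
  have h1 := continuous_fourier_schwartz χ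
  have h2 := continuous_avgMult k
  unfold diffMult
  fun_prop

/-- For |2^k ξ| ≤ 1/4 the first multiplier is 1 and the second is 1 up to a linear error. For |2^k
ξ| > 1/2 the first vanishes and the second decays. -/
lemma IsAdmissible.norm_diffMult_le {χ : 𝓢(ℝ, ℂ)} (hχ : IsAdmissible χ) (k : ℕ) (ξ : ℝ) :
    ‖diffMult χ k ξ‖ ≤ 16 * |2 ^ k * ξ| ∧ ‖diffMult χ k ξ‖ * |2 ^ k * ξ| ≤ 1 := by
  have hneg : |2 ^ k * -ξ| = |2 ^ k * ξ| := by rw [mul_neg, abs_neg]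
  have a1 := norm_avgMult_le_one k ξ
  have a2 := norm_avgMult_le_one k (-ξ)
  have b1 := norm_avgMult_sub_one_le k ξ
  have b2 := norm_avgMult_sub_one_le k (-ξ)
  have c1 := norm_avgMult_mul_le k ξ
  rw [hneg] at b2
  have hpi := Real.pi_lt_d2
  unfold diffMult
  set η := |2 ^ k * ξ| with hη
  have hη0 : 0 ≤ η := abs_nonneg _
  set p := avgMult k ξ
  set q := avgMult k (-ξ)
  set X := 𝓕 (χ : ℝ → ℂ) (2 ^ k * ξ) with hX
  have hX1 : ‖X‖ * η ≤ 1 / 2 := by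
    rcases le_or_gt η (1 / 2) with h | h
    · nlinarith [hχ.norm_le_one (2 ^ k * ξ), norm_nonneg X]
    · rw [hX, hχ.eq_zero h]; simp
  have main : ‖X - q * p‖ * η ≤ 1 := by
    have hqp : ‖q * p‖ ≤ ‖p‖ := by
      rw [norm_mul]; exact mul_le_of_le_one_left (norm_nonneg _) a2
    have := norm_sub_le X (q * p)
    nlinarith
  refine ⟨?_, main⟩
  rcases le_or_gt η (1 / 4) with h | h
  · rw [hX, hχ.eq_one h, show (1 : ℂ) - q * p = -((q - 1) * p + (p - 1)) by ring, norm_neg]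
    have h1 := norm_add_le ((q - 1) * p) (p - 1)
    rw [norm_mul] at h1
    have h2 : ‖q - 1‖ * ‖p‖ ≤ ‖q - 1‖ := mul_le_of_le_one_right (norm_nonneg _) a1
    nlinarith
  · nlinarith [norm_nonneg (X - q * p)]

lemma IsAdmissible.norm_diffMult_le_const {χ : 𝓢(ℝ, ℂ)} (hχ : IsAdmissible χ) (k : ℕ) (ξ : ℝ) :
    ‖diffMult χ k ξ‖ ≤ 4 := by
  obtain ⟨h1, h2⟩ := hχ.norm_diffMult_le k ξ
  by_contra! h
  nlinarith [abs_nonneg (2 ^ k * ξ)]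

/-- With s = |2^k ξ|, min(s, 1/s)² is bounded by a multiple of the increment of t/(1 + t) from s² to
4s². The right side has this form so that the sum over k telescopes. -/
lemma IsAdmissible.norm_diffMult_sq_le {χ : 𝓢(ℝ, ℂ)} (hχ : IsAdmissible χ) (k : ℕ) (ξ : ℝ) :
    ‖diffMult χ k ξ‖ ^ 2 ≤ 1000 * ((2 ^ (k + 1) * ξ) ^ 2 / (1 + (2 ^ (k + 1) * ξ) ^ 2) -
      (2 ^ k * ξ) ^ 2 / (1 + (2 ^ k * ξ) ^ 2)) := by
  obtain ⟨h1, h2⟩ := hχ.norm_diffMult_le k ξ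
  rw [show (2 : ℝ) ^ (k + 1) * ξ = 2 * (2 ^ k * ξ) by ring, mul_pow, ← sq_abs (2 ^ k * ξ)]
  set r := ‖diffMult χ k ξ‖
  set s := |2 ^ k * ξ|
  have hr : 0 ≤ r := norm_nonneg _
  have hs : 0 ≤ s := abs_nonneg _
  have e : 2 ^ 2 * s ^ 2 / (1 + 2 ^ 2 * s ^ 2) - s ^ 2 / (1 + s ^ 2) =
      3 * s ^ 2 / ((1 + s ^ 2) * (1 + 4 * s ^ 2)) := by
    field_simp; ring
  rw [e, mul_div_assoc', le_div_iff₀ (by positivity)]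
  have A : r ^ 2 ≤ 256 * s ^ 2 := by
    have := pow_le_pow_left₀ hr h1 2
    nlinarith
  have B : r ^ 2 * s ^ 2 ≤ 1 := by
    have := pow_le_pow_left₀ (by positivity) h2 2
    nlinarith
  have D : r ^ 2 * s ^ 4 ≤ s ^ 2 := by nlinarith [sq_nonneg s]
  have E : r ^ 2 * s ^ 2 ≤ 26 * s ^ 2 := by
    rcases le_or_gt (r ^ 2) 26 with h | h
    · nlinarith [sq_nonneg s]
    · nlinarith [sq_nonneg s]
  nlinarith

end Multipliers

/-! ### Passage to frequency bands and the square function of the error. -/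

section Reduction

/-- The part of `F` within distance `1/2` of `θ`, moved to the origin. -/
def band (F : ℝ → ℂ) (θ : ℝ) : ℝ → ℂ :=
  (Set.Icc (-1 / 2 : ℝ) (1 / 2)).indicator fun ξ => F (ξ + θ)

lemma band_eq_zero (F : ℝ → ℂ) (θ : ℝ) {ξ : ℝ} (h : 1 / 2 < |ξ|) : band F θ ξ = 0 :=
  Set.indicator_of_notMem
    (fun h' => absurd (abs_le.2 ⟨by linarith [h'.1], h'.2⟩) (not_le.2 h)) _

lemma band_eq (F : ℝ → ℂ) (θ : ℝ) {ξ : ℝ} (h : |ξ| ≤ 1 / 2) : band F θ ξ = F (ξ + θ) := by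
  obtain ⟨h1, h2⟩ := abs_le.1 h
  exact Set.indicator_of_mem (Set.mem_Icc.2 ⟨by linarith, h2⟩) _

lemma memLp_band {F : ℝ → ℂ} (hF : MemLp F 2) (θ : ℝ) : MemLp (band F θ) 2 :=
  (hF.comp_measurePreserving (measurePreserving_add_right volume θ)).indicator measurableSet_Icc

lemma integrable_band {F : ℝ → ℂ} (hF : MemLp F 2) (θ : ℝ) : Integrable (band F θ) := by
  refine (integrable_indicator_iff measurableSet_Icc).2 ?_
  exact ((hF.comp_measurePreserving (measurePreserving_add_right volume θ)).restrict _).integrable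
    (by norm_num)

lemma sum_lintegral_band_sq_le {N : ℕ} {θ : Fin N → ℝ} (hθ : OneSeparated θ) {F : ℝ → ℂ}
    (hF : MemLp F 2) : ∑ n, ∫⁻ ξ, ‖band F (θ n) ξ‖ₑ ^ 2 ≤ ∫⁻ ξ, ‖F ξ‖ₑ ^ 2 := by
  have e : ∀ n, ∫⁻ ξ, ‖band F (θ n) ξ‖ₑ ^ 2 = ∫⁻ ξ, ‖band F (θ n) (ξ - θ n)‖ₑ ^ 2 := fun n =>
    (lintegral_sub_right_eq_self (fun ξ => ‖band F (θ n) ξ‖ₑ ^ 2) (θ n)).symm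
  simp_rw [e]
  have hm : ∀ n, AEMeasurable fun ξ => ‖band F (θ n) (ξ - θ n)‖ₑ ^ 2 := fun n =>
    ((memLp_band hF (θ n)).comp_measurePreserving
      (measurePreserving_sub_right volume (θ n))).aestronglyMeasurable.enorm.pow_const 2
  rw [← lintegral_finsetSum' _ fun n _ => hm n]
  refine lintegral_mono fun ξ => ?_
  by_cases h : ∃ n, |ξ - θ n| ≤ 1 / 2
  · obtain ⟨n, hn⟩ := h
    rw [Finset.sum_eq_single n]
    · rw [band_eq F _ hn]; simp
    · intro j _ hj
      rw [band_eq_zero F _ ((hθ.half_lt_abs ξ hj).resolve_right (not_lt.2 hn))]; simp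
    · simp
  · push Not at h
    rw [Finset.sum_eq_zero fun n _ => by rw [band_eq_zero F _ (h n)]; simp]
    exact zero_le

lemma fourier_modulate_dilate (χ : 𝓢(ℝ, ℂ)) (k : ℕ) (θ x y : ℝ) :
    𝓕 (fun ξ => 𝓕 (χ : ℝ → ℂ) (2 ^ k * (ξ - θ)) * ee (ξ * x)) y =
      modulate θ (dil k χ) (x - y) := by
  have hinv : 𝓕⁻ (𝓕 (χ : ℝ → ℂ)) = χ :=
    χ.continuous.fourierInv_fourier_eq χ.integrable
      (by rw [← SchwartzMap.fourier_coe]; exact (𝓕 χ : 𝓢(ℝ, ℂ)).integrable)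
  have h2 : (2 : ℝ) ^ k ≠ 0 := by positivity
  rw [fourier_eq_ee, modulate, dil, ← congrFun hinv, fourierInv_eq_ee,
    ← integral_add_right_eq_self _ θ]
  have e : ∀ η : ℝ, ee (-((η + θ) * y)) *
      (𝓕 (χ : ℝ → ℂ) (2 ^ k * (η + θ - θ)) * ee ((η + θ) * x)) =
      (fun ζ => ee (θ * (x - y)) * (ee (ζ * ((2 ^ k)⁻¹ * (x - y))) * 𝓕 (χ : ℝ → ℂ) ζ))
        (2 ^ k * η) := by
    intro η
    have : ee (-((η + θ) * y)) * ee ((η + θ) * x) =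
        ee (θ * (x - y)) * ee (2 ^ k * η * ((2 ^ k)⁻¹ * (x - y))) := by
      rw [← ee_add, ← ee_add]
      congr 1
      field_simp
      ring
    simp only [add_sub_cancel_right]
    rw [mul_left_comm, this]
    ring
  rw [integral_congr_ae (.of_forall e), Measure.integral_comp_mul_left
    (fun ζ => ee (θ * (x - y)) * (ee (ζ * ((2 ^ k)⁻¹ * (x - y))) * 𝓕 (χ : ℝ → ℂ) ζ)),
    integral_const_mul, abs_of_pos (by positivity)]
  rw [show Complex.exp (2 * Real.pi * Complex.I * (θ * (x - y) : ℝ)) = ee (θ * (x - y)) from rfl,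
    Complex.real_smul, mul_left_comm]
  push_cast
  rfl

/-- Since f is only in L², the convolution is evaluated by duality: the kernel at x − y, as a
function of y, is the transform of the smooth compactly supported ψ(ξ) = χ̂(2^k(ξ − θ)) e(ξx), and
the transform moves onto f. Because 2^k ≥ 1, ψ lives within 1/2 of θ, so only the band enters. -/
lemma IsAdmissible.convolution_eq {χ : 𝓢(ℝ, ℂ)} (hχ : IsAdmissible χ) {f : ℝ → ℂ}
    (hf : MemLp f 2) (k : ℕ) (θ x : ℝ) :
    (modulate θ (dil k χ) ⋆[ContinuousLinearMap.mul ℂ ℂ, volume] f) x =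
      ee (θ * x) * 𝓕⁻ (fun ξ => 𝓕 (χ : ℝ → ℂ) (2 ^ k * ξ) *
        band (𝓕 (hf.toLp f) : Lp ℂ 2 (volume : Measure ℝ)) θ ξ) x := by
  set F : Lp ℂ 2 (volume : Measure ℝ) := 𝓕 (hf.toLp f) with hF
  have h2 : (1 : ℝ) ≤ 2 ^ k := one_le_pow₀ (by norm_num)
  have hsmooth : ContDiff ℝ (⊤ : ℕ∞) (𝓕 (χ : ℝ → ℂ)) := by
    rw [← SchwartzMap.fourier_coe]; exact (𝓕 χ : 𝓢(ℝ, ℂ)).smooth ⊤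
  have hcs : HasCompactSupport fun ξ => 𝓕 (χ : ℝ → ℂ) (2 ^ k * (ξ - θ)) * ee (ξ * x) := by
    refine HasCompactSupport.intro (isCompact_Icc (a := θ - 1 / 2) (b := θ + 1 / 2))
      fun ξ hξ => ?_
    have : 1 / 2 < |ξ - θ| := by
      by_contra! h
      obtain ⟨h1, h2⟩ := abs_le.1 h
      exact hξ ⟨by linarith, by linarith⟩
    rw [hχ.eq_zero, zero_mul]
    rw [abs_mul, abs_of_pos (by positivity : (0 : ℝ) < 2 ^ k)]
    nlinarith [abs_nonneg (ξ - θ)]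
  set ψ : 𝓢(ℝ, ℂ) := hcs.toSchwartzMap 
    ((hsmooth.comp (g := 𝓕 (χ : ℝ → ℂ)) (f := fun ξ => 2 ^ k * (ξ - θ)) (by fun_prop)).mul
      (contDiff_ee.comp (f := fun ξ => ξ * x) (by fun_prop)))
  have hψ : ∀ ξ, ψ ξ = 𝓕 (χ : ℝ → ℂ) (2 ^ k * (ξ - θ)) * ee (ξ * x) := fun _ => rfl
  have hψ' : (ψ : ℝ → ℂ) = fun ξ => 𝓕 (χ : ℝ → ℂ) (2 ^ k * (ξ - θ)) * ee (ξ * x) := rfl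
  rw [convolution_def, ← integral_sub_left_eq_self _ volume x]
  simp only [sub_sub_cancel, ContinuousLinearMap.mul_apply']
  simp_rw [← fourier_modulate_dilate]
  rw [← hψ', ← integral_mul_fourier_toLp hf ψ, ee_mul_fourierInv, fourierInv_eq_ee]
  refine integral_congr_ae (.of_forall fun ξ => ?_)
  simp only [hψ]
  rcases le_or_gt |ξ - θ| (1 / 2) with h | h
  · rw [band_eq _ _ h, sub_add_cancel]; ring
  · rw [band_eq_zero _ _ h, hχ.eq_zero]
    · simp
    · rw [abs_mul, abs_of_pos (by positivity : (0 : ℝ) < 2 ^ k)]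
      nlinarith [abs_nonneg (ξ - θ)]

lemma IsAdmissible.Xi_sub_eq {χ : 𝓢(ℝ, ℂ)} (hχ : IsAdmissible χ) {f : ℝ → ℂ} (hf : MemLp f 2)
    {N : ℕ} (θ : Fin N → ℝ) (k : ℕ) (x : ℝ) :
    Xi χ θ k f x - ∑ n, ee (θ n * x) *
        tentAvg (𝓕⁻ (band (𝓕 (hf.toLp f) : Lp ℂ 2 (volume : Measure ℝ)) (θ n))) k x =
      ∑ n, ee (θ n * x) * 𝓕⁻ (fun ξ => diffMult χ k ξ *
        band (𝓕 (hf.toLp f) : Lp ℂ 2 (volume : Measure ℝ)) (θ n) ξ) x := by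
  set F : Lp ℂ 2 (volume : Measure ℝ) := 𝓕 (hf.toLp f)
  rw [Xi, ← Finset.sum_sub_distrib]
  refine Finset.sum_congr rfl fun n _ => ?_
  have hG := integrable_band (Lp.memLp F) (θ n)
  rw [hχ.convolution_eq hf, tentAvg_fourierInv hG, ← mul_sub]
  congr 1
  have hb : ∀ m : ℝ → ℂ, Continuous m → (∀ ξ, ‖m ξ‖ ≤ 1) →
      Integrable fun ξ => ee (ξ * x) * (m ξ * band F (θ n) ξ) := fun m hm hm1 =>
    (integrable_mul_of_bounded hG hm hm1).bdd_mul (c := 1)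
      (Continuous.aestronglyMeasurable (by fun_prop)) (.of_forall fun ξ => by simp)
  have hc1 := continuous_fourier_schwartz χ
  have hc2 := continuous_avgMult k
  rw [fourierInv_eq_ee, fourierInv_eq_ee, fourierInv_eq_ee, ← integral_sub]
  · refine integral_congr_ae (.of_forall fun ξ => ?_)
    simp only [diffMult]
    ring
  · exact hb (fun ξ => 𝓕 (χ : ℝ → ℂ) (2 ^ k * ξ)) (by fun_prop) fun ξ => hχ.norm_le_one _
  · refine hb (fun ξ => avgMult k (-ξ) * avgMult k ξ) (by fun_prop) fun ξ => ?_
    rw [norm_mul]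
    exact mul_le_one₀ (norm_avgMult_le_one _ _) (norm_nonneg _) (norm_avgMult_le_one _ _)

lemma IsAdmissible.tsum_diffMult_sq_le {χ : 𝓢(ℝ, ℂ)} (hχ : IsAdmissible χ) (ξ : ℝ) :
    ∑' k, ‖diffMult χ k ξ‖ₑ ^ 2 ≤ 1000 := by
  refine ENNReal.tsum_le_of_sum_range_le fun K => ?_
  have e : ∀ k, ‖diffMult χ k ξ‖ₑ ^ 2 = ENNReal.ofReal (‖diffMult χ k ξ‖ ^ 2) := fun k => by
    rw [ENNReal.ofReal_pow (norm_nonneg _), ofReal_norm]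
  simp_rw [e]
  rw [← ENNReal.ofReal_sum_of_nonneg fun _ _ => by positivity,
    show (1000 : ℝ≥0∞) = ENNReal.ofReal 1000 by norm_num]
  refine ENNReal.ofReal_le_ofReal
    ((Finset.sum_le_sum fun k _ => hχ.norm_diffMult_sq_le k ξ).trans ?_)
  rw [← Finset.mul_sum,
    Finset.sum_range_sub (fun k => (2 ^ k * ξ) ^ 2 / (1 + (2 ^ k * ξ) ^ 2))]
  have h1 : (2 ^ K * ξ) ^ 2 / (1 + (2 ^ K * ξ) ^ 2) ≤ 1 :=
    div_le_one_of_le₀ (by linarith) (by positivity)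
  have h2 : 0 ≤ (2 ^ 0 * ξ) ^ 2 / (1 + (2 ^ 0 * ξ) ^ 2) := by positivity
  linarith

/-- The square function comparing `Ξ_k f` with the averaged dyadic averages. -/
theorem IsAdmissible.lintegral_tsum_Xi_sub_sq_le {χ : 𝓢(ℝ, ℂ)} (hχ : IsAdmissible χ)
    {f : ℝ → ℂ} (hf : MemLp f 2) {N : ℕ} {θ : Fin N → ℝ} (hθ : OneSeparated θ) :
    ∑' k, ∫⁻ x, ‖Xi χ θ k f x - ∑ n, ee (θ n * x) *
        tentAvg (𝓕⁻ (band (𝓕 (hf.toLp f) : Lp ℂ 2 (volume : Measure ℝ)) (θ n))) k x‖ₑ ^ 2 ≤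
      1000 * ∫⁻ x, ‖f x‖ₑ ^ 2 := by
  simp_rw [hχ.Xi_sub_eq hf]
  set F : Lp ℂ 2 (volume : Measure ℝ) := 𝓕 (hf.toLp f) with hF
  have hb := hχ.norm_diffMult_le_const
  have hm : ∀ n, AEMeasurable (fun ξ => ‖band F (θ n) ξ‖ₑ ^ 2) := fun n =>
    (integrable_band (Lp.memLp F) (θ n)).aestronglyMeasurable.enorm.pow_const 2
  have hmk : ∀ k, Measurable fun ξ => ‖diffMult χ k ξ‖ₑ ^ 2 := fun k =>
    (continuous_diffMult χ k).enorm.measurable.pow_const 2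
  have h1 : ∀ k, ∫⁻ x, ‖∑ n, ee (θ n * x) * 𝓕⁻ (fun ξ => diffMult χ k ξ *
      band F (θ n) ξ) x‖ₑ ^ 2 = ∑ n, ∫⁻ ξ, ‖diffMult χ k ξ‖ₑ ^ 2 * ‖band F (θ n) ξ‖ₑ ^ 2 := by
    intro k
    rw [lintegral_sum_modulate_sq hθ]
    · simp_rw [enorm_mul, mul_pow]
    · exact fun n => integrable_mul_of_bounded (integrable_band (Lp.memLp F) _)
        (continuous_diffMult χ k) (hb k)
    · exact fun n => (memLp_band (Lp.memLp F) _).of_le_mul (c := 4)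
        ((continuous_diffMult χ k).aestronglyMeasurable.mul
          (memLp_band (Lp.memLp F) _).aestronglyMeasurable) (.of_forall fun ξ => by
            rw [norm_mul]; exact mul_le_mul_of_nonneg_right (hb k ξ) (norm_nonneg _))
    · intro n ξ hξ
      rw [band_eq_zero _ _ hξ, mul_zero]
  simp_rw [h1]
  rw [Summable.tsum_finsetSum fun _ _ => ENNReal.summable]
  calc ∑ n, ∑' k, ∫⁻ ξ, ‖diffMult χ k ξ‖ₑ ^ 2 * ‖band F (θ n) ξ‖ₑ ^ 2
      = ∑ n, ∫⁻ ξ, (∑' k, ‖diffMult χ k ξ‖ₑ ^ 2) * ‖band F (θ n) ξ‖ₑ ^ 2 := by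
        refine Finset.sum_congr rfl fun n _ => ?_
        have hkn : ∀ k, AEMeasurable fun ξ => ‖diffMult χ k ξ‖ₑ ^ 2 * ‖band F (θ n) ξ‖ₑ ^ 2 :=
          fun k => (hmk k).aemeasurable.mul (hm n)
        rw [← lintegral_tsum hkn]
        simp_rw [ENNReal.tsum_mul_right]
    _ ≤ ∑ n, ∫⁻ ξ, 1000 * ‖band F (θ n) ξ‖ₑ ^ 2 := by
        gcongr with n _ ξ
        exact hχ.tsum_diffMult_sq_le ξ
    _ = 1000 * ∑ n, ∫⁻ ξ, ‖band F (θ n) ξ‖ₑ ^ 2 := by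
        rw [Finset.mul_sum]
        exact Finset.sum_congr rfl fun n _ => lintegral_const_mul' _ _ (by norm_num)
    _ ≤ 1000 * ∫⁻ ξ, ‖F ξ‖ₑ ^ 2 := by
        gcongr
        exact sum_lintegral_band_sq_le hθ (Lp.memLp F)
    _ = _ := by rw [← eLpNorm_two_sq, ← eLpNorm_two_sq, hF, eLpNorm_fourier_toLp]

end Reduction

/-! ### Averaging over translated grids. -/

section GridAveraging

/-- The exponential sum `v ↦ ∑ e(θ_n x) v_n`. -/
def expSum {N : ℕ} (θ : Fin N → ℝ) (x : ℝ) : EuclideanSpace ℂ (Fin N) →+ ℂ where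
  toFun v := ∑ n, ee (θ n * x) * v n
  map_zero' := by simp
  map_add' v w := by simp [mul_add, Finset.sum_add_distrib]

lemma expSum_apply {N : ℕ} (θ : Fin N → ℝ) (x : ℝ) (v : EuclideanSpace ℂ (Fin N)) :
    expSum θ x v = ∑ n, ee (θ n * x) * v n := rfl

lemma norm_expSum_le {N : ℕ} (θ : Fin N → ℝ) (x : ℝ) (v : EuclideanSpace ℂ (Fin N)) :
    ‖expSum θ x v‖ ≤ N * ‖v‖ := by
  rw [expSum_apply]
  refine (norm_sum_le_of_le _ (f := fun n => ee (θ n * x) * v n) (n := fun _ => ‖v‖)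
    fun n _ => ?_).trans (by simp)
  rw [norm_mul, norm_ee, one_mul]
  exact PiLp.norm_apply_le v n

lemma avg_apply {N : ℕ} {g : ℝ → EuclideanSpace ℂ (Fin N)} (hg : Continuous g) (k : ℕ) (a : ℝ)
    (n : Fin N) : avg g k a n = avg (fun t => g t n) k a := by
  have := (EuclideanSpace.proj (𝕜 := ℂ) n).intervalIntegral_comp_comm (μ := volume)
    (hg.intervalIntegrable a (a + 2 ^ k))
  simp only [PiLp.proj_apply] at this
  simp only [avg, this]
  rfl

lemma continuous_avg {h : ℝ → ℂ} (hh : Continuous h) (k : ℕ) : Continuous (avg h k) := by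
  have h1 : Continuous fun a => ∫ s in (0 : ℝ)..2 ^ k, h (a + s) :=
    intervalIntegral.continuous_parametric_intervalIntegral_of_continuous' (by fun_prop) _ _
  have e : avg h k = fun a => ((2 : ℝ) ^ k)⁻¹ • ∫ s in (0 : ℝ)..2 ^ k, h (a + s) := by
    ext a
    rw [avg, intervalIntegral.integral_comp_add_left (fun t => h t)]
    simp
  rw [e]
  exact h1.const_smul (((2 : ℝ) ^ k)⁻¹)

/-- Averages over one period, seen from a multiple of the period. -/
lemma inv_smul_integral_periodize {Φ : ℝ → ℂ} (hΦ : Continuous Φ) {k K : ℕ} (hk : k ≤ K) :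
    ((2 : ℝ) ^ K)⁻¹ • ∫ y in (0 : ℝ)..2 ^ K, Φ (y - 2 ^ k * ⌊y / 2 ^ k⌋) =
      ((2 : ℝ) ^ k)⁻¹ • ∫ y in (0 : ℝ)..2 ^ k, Φ y := by
  set ψ : ℝ → ℂ := fun y => Φ (y - 2 ^ k * ⌊y / 2 ^ k⌋)
  have hT : (0 : ℝ) < 2 ^ k := by positivity
  have hper : Function.Periodic ψ (2 ^ k) := by
    intro y
    simp only [ψ]
    rw [add_div, div_self hT.ne', Int.floor_add_one]
    congr 1
    push_cast; ring
  have heq : Set.EqOn Φ ψ (Set.Ioo 0 (2 ^ k)) := by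
    intro y hy
    have : ⌊y / 2 ^ k⌋ = 0 := by
      rw [Int.floor_eq_zero_iff]
      exact ⟨div_nonneg hy.1.le hT.le, (div_lt_one hT).2 hy.2⟩
    simp [ψ, this]
  have hint : IntervalIntegrable ψ volume 0 (0 + 2 ^ k) := by
    rw [zero_add]
    refine (hΦ.intervalIntegrable 0 (2 ^ k)).congr_ae ?_
    rw [Set.uIoc_of_le hT.le, Filter.EventuallyEq, ← restrict_Ioo_eq_restrict_Ioc,
      ae_restrict_iff' measurableSet_Ioo]
    exact .of_forall heq
  have h1 := hper.intervalIntegral_add_zsmul_eq (2 ^ (K - k) : ℕ) 0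
    (fun t₁ t₂ => hper.intervalIntegrable hT.ne' hint t₁ t₂)
  have e : (0 : ℝ) + ((2 ^ (K - k) : ℕ) : ℤ) • (2 : ℝ) ^ k = 2 ^ K := by
    rw [zero_add, zsmul_eq_mul]; push_cast; rw [← pow_add]; congr 1; omega
  rw [e, zero_add] at h1
  have h2 : ∫ y in (0 : ℝ)..2 ^ k, ψ y = ∫ y in (0 : ℝ)..2 ^ k, Φ y := by
    rw [intervalIntegral.integral_of_le hT.le, intervalIntegral.integral_of_le hT.le,
      integral_Ioc_eq_integral_Ioo, integral_Ioc_eq_integral_Ioo]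
    exact setIntegral_congr_fun measurableSet_Ioo fun y hy => (heq hy).symm
  rw [h1, h2, ← Int.cast_smul_eq_zsmul ℝ, smul_smul]
  congr 1
  push_cast
  rw [← Nat.sub_add_cancel hk, pow_add]
  simp only [Nat.add_sub_cancel]
  field_simp

lemma sq_lintegral_le {α : Type*} [MeasurableSpace α] {μ : Measure α} {S : α → ℝ≥0∞}
    (hS : AEMeasurable S μ) : (∫⁻ x, S x ∂μ) ^ 2 ≤ μ Set.univ * ∫⁻ x, S x ^ 2 ∂μ := by
  have h := ENNReal.lintegral_mul_le_Lp_mul_Lq μ (p := 2) (q := 2)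
    (Real.HolderConjugate.two_two) hS (aemeasurable_const (b := (1 : ℝ≥0∞)))
  simp only [Pi.mul_apply, mul_one, ENNReal.one_rpow, lintegral_const, one_mul] at h
  calc (∫⁻ x, S x ∂μ) ^ 2 ≤ ((∫⁻ x, S x ^ (2 : ℝ) ∂μ) ^ (1 / 2 : ℝ) *
        μ Set.univ ^ (1 / 2 : ℝ)) ^ 2 := by gcongr
    _ = _ := by
        rw [mul_pow, ← ENNReal.rpow_natCast, ← ENNReal.rpow_natCast, ← ENNReal.rpow_mul,
          ← ENNReal.rpow_mul, mul_comm]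
        norm_num

/-- In the grid with origin x − y, the block of length 2^k containing x starts at x − (y mod 2^k).
Since 2^K is a whole number of periods, one family of grids serves all scales k ≤ K. -/
lemma sum_expSum_tentAvg {N : ℕ} (θ : Fin N → ℝ) {h : Fin N → ℝ → ℂ}
    (hh : ∀ n, Continuous (h n)) {k K : ℕ} (hk : k ≤ K) (x : ℝ) :
    ∑ n, ee (θ n * x) * tentAvg (h n) k x = ((2 : ℝ) ^ K)⁻¹ • ∫ y in (0 : ℝ)..2 ^ K,
      expSum θ x (avg (fun t => WithLp.toLp 2 fun n => h n t) k
        (x - y + 2 ^ k * ⌊(x - (x - y)) / 2 ^ k⌋)) := by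
  have hg : Continuous fun t => (WithLp.toLp 2 fun n => h n t : EuclideanSpace ℂ (Fin N)) := by
    fun_prop
  have hc : ∀ n, Continuous fun y => avg (h n) k (x - y) := fun n =>
    (continuous_avg (hh n) k).comp (by fun_prop)
  have e : ∀ a, expSum θ x (avg (fun t => WithLp.toLp 2 fun n => h n t) k a) =
      ∑ n, ee (θ n * x) * avg (h n) k a := by
    intro a
    rw [expSum_apply]
    simp_rw [avg_apply hg]
  have hp := inv_smul_integral_periodize
    (Φ := fun y => ∑ n, ee (θ n * x) * avg (h n) k (x - y)) (by fun_prop) hk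
  simp_rw [e]
  simp only [sub_sub_cancel]
  simp only [← sub_add] at hp
  rw [hp, intervalIntegral.integral_finsetSum
    fun n _ => Continuous.intervalIntegrable (by fun_prop) _ _, Finset.smul_sum]
  refine Finset.sum_congr rfl fun n _ => ?_
  rw [intervalIntegral.integral_const_mul, tentAvg, mul_smul_comm]

/-- The maximal inequality for the averages of the dyadic averages over all translated grids. -/
theorem lintegral_iSup_tentAvg_sq_le {N : ℕ} {θ : Fin N → ℝ} (hθ : OneSeparated θ)
    {h : Fin N → ℝ → ℂ} (hh : ∀ n, Continuous (h n)) {L : ℕ} (hL : N ≤ 2 ^ L) (K : ℕ) :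
    ∫⁻ x, (⨆ k ≤ K, ‖∑ n, ee (θ n * x) * tentAvg (h n) k x‖ₑ) ^ 2 ≤
      ENNReal.ofReal ((L + 1) * (4 + L * (18 * 32))) * ∑ n, ∫⁻ x, ‖h n x‖ₑ ^ 2 := by
  set g : ℝ → EuclideanSpace ℂ (Fin N) := fun t => WithLp.toLp 2 fun n => h n t with hgdef
  have hg : Continuous g := by fun_prop
  set c := ENNReal.ofReal ((L + 1) * (4 + L * (18 * 32))) with hc
  set T : ℝ := 2 ^ K with hTdef
  have hT : 0 < T := by positivity
  set I : Set ℝ := Set.Ico 0 T with hI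
  have hIv : (volume.restrict I) Set.univ = ENNReal.ofReal T := by simp [hI]
  set S : ℝ → ℝ → ℝ≥0∞ := fun u x =>
    ⨆ k ≤ K, ‖expSum θ x (avg g k (u + 2 ^ k * ⌊(x - u) / 2 ^ k⌋))‖ₑ with hS
  have hSm : Measurable fun p : ℝ × ℝ => S p.1 p.2 := by
    refine Measurable.iSup fun k => Measurable.iSup fun _ => ?_
    have h1 : Continuous fun p : ℝ × ℝ => expSum θ p.1 (avg g k p.2) := by
      simp_rw [expSum_apply, avg_apply hg]
      have := fun n => continuous_avg (hh n) k
      simp only [hgdef]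
      fun_prop
    have h2 : Measurable fun p : ℝ × ℝ => (p.2, p.1 + 2 ^ k * (⌊(p.2 - p.1) / 2 ^ k⌋ : ℝ)) := by
      fun_prop
    exact (h1.measurable.comp h2).enorm
  -- The supremum moves inside the average over grids, then Cauchy–Schwarz moves the square inside.
  have hpt : ∀ x, (⨆ k ≤ K, ‖∑ n, ee (θ n * x) * tentAvg (h n) k x‖ₑ) ^ 2 ≤
      (ENNReal.ofReal T)⁻¹ * ∫⁻ y in I, S (x - y) x ^ 2 := by
    intro x
    have h1 : (⨆ k ≤ K, ‖∑ n, ee (θ n * x) * tentAvg (h n) k x‖ₑ) ≤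
        (ENNReal.ofReal T)⁻¹ * ∫⁻ y in I, S (x - y) x := by
      refine iSup₂_le fun k hk => ?_
      rw [sum_expSum_tentAvg θ hh hk, enorm_smul, intervalIntegral.integral_of_le hT.le]
      gcongr
      · rw [← ofReal_norm, norm_inv, Real.norm_of_nonneg hT.le, ENNReal.ofReal_inv_of_pos hT]
      · refine (enorm_integral_le_lintegral_enorm _).trans ?_
        rw [restrict_Ico_eq_restrict_Ioc.symm]
        refine lintegral_mono fun y => ?_
        exact le_iSup₂ (f := fun k (_ : k ≤ K) =>
          ‖expSum θ x (avg g k (x - y + 2 ^ k * ⌊(x - (x - y)) / 2 ^ k⌋))‖ₑ) k hk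
    have hm : Measurable fun y => S (x - y) x :=
      hSm.comp (f := fun y => (x - y, x)) (by fun_prop)
    calc _ ≤ ((ENNReal.ofReal T)⁻¹ * ∫⁻ y in I, S (x - y) x) ^ 2 := by gcongr
      _ = (ENNReal.ofReal T)⁻¹ * ((ENNReal.ofReal T)⁻¹ * (∫⁻ y in I, S (x - y) x) ^ 2) := by ring
      _ ≤ (ENNReal.ofReal T)⁻¹ * ((ENNReal.ofReal T)⁻¹ * (ENNReal.ofReal T *
            ∫⁻ y in I, S (x - y) x ^ 2)) := by
          gcongr
          have := sq_lintegral_le (μ := volume.restrict I) hm.aemeasurable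
          rwa [hIv] at this
      _ = _ := by
          rw [← mul_assoc (ENNReal.ofReal T)⁻¹ (ENNReal.ofReal T), ENNReal.inv_mul_cancel
            (by simpa using hT) (by simp), one_mul]
  have hblock : ∀ u, ∫⁻ x in Set.Ico u (u + T), S u x ^ 2 ≤
      c * ∫⁻ s in I, ‖g (s + u)‖ₑ ^ 2 := by
    intro u
    refine (lintegral_iSup_avg_sq_le hg (expSum θ) (B := N) (C := 32) (by positivity)
      (by norm_num) ?_ (norm_expSum_le θ) ?_ (by exact_mod_cast hL) K u).trans ?_
    · intro v
      simp_rw [expSum_apply]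
      exact Continuous.measurable (by fun_prop)
    · intro b v
      refine (lintegral_exponential_sum_sq_le hθ (fun n => v n) b).trans (le_of_eq ?_)
      rw [EuclideanSpace.norm_sq_eq, ENNReal.ofReal_mul (by norm_num),
        ENNReal.ofReal_sum_of_nonneg fun _ _ => by positivity]
      simp [ENNReal.ofReal_pow]
    · rw [ENNReal.ofReal_mul (by positivity), hc, ← setLIntegral_Ico_add (fun t => ‖g t‖ₑ ^ 2)]
      gcongr
      rw [intervalIntegral.integral_of_le (by linarith), ← integral_Ico_eq_integral_Ioc,
        ofReal_integral_eq_lintegral_ofReal]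
      · refine le_of_eq (lintegral_congr fun t => ?_)
        rw [ENNReal.ofReal_pow (norm_nonneg _), ofReal_norm]
      · exact ((hg.norm.pow 2).integrableOn_Icc).mono_set Set.Ico_subset_Icc_self
      · exact .of_forall fun _ => by positivity
  have hgn : ∀ t, ‖g t‖ₑ ^ 2 = ∑ n, ‖h n t‖ₑ ^ 2 := by
    intro t
    rw [← ofReal_norm, ← ENNReal.ofReal_pow (norm_nonneg _), EuclideanSpace.norm_sq_eq,
      ENNReal.ofReal_sum_of_nonneg fun _ _ => by positivity]
    simp [ENNReal.ofReal_pow, hgdef]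
  have hSm2 : Measurable fun p : ℝ × ℝ => S (p.1 - p.2) p.1 ^ 2 :=
    (hSm.comp (f := fun p : ℝ × ℝ => (p.1 - p.2, p.1)) (by fun_prop)).pow_const 2
  have hSm3 : Measurable fun p : ℝ × ℝ => S p.2 (p.2 + p.1) ^ 2 :=
    (hSm.comp (f := fun p : ℝ × ℝ => (p.2, p.2 + p.1)) (by fun_prop)).pow_const 2
  calc _ ≤ ∫⁻ x, (ENNReal.ofReal T)⁻¹ * ∫⁻ y in I, S (x - y) x ^ 2 := lintegral_mono hpt
    _ = (ENNReal.ofReal T)⁻¹ * ∫⁻ x, ∫⁻ y in I, S (x - y) x ^ 2 :=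
        lintegral_const_mul' _ _ (by simpa using hT)
    _ = (ENNReal.ofReal T)⁻¹ * ∫⁻ y in I, ∫⁻ x, S (x - y) x ^ 2 := by
        rw [lintegral_lintegral_swap hSm2.aemeasurable]
    _ = (ENNReal.ofReal T)⁻¹ * ∫⁻ y in I, ∫⁻ u, S u (u + y) ^ 2 := by
        congr 1
        refine lintegral_congr fun y => ?_
        rw [← lintegral_add_right_eq_self (fun x => S (x - y) x ^ 2) y]
        simp
    -- With u = x − y fixed, x runs over exactly the root block [u, u + T), so the bound for one
    -- tree applies; the factor T lost there cancels in the end.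
    _ = (ENNReal.ofReal T)⁻¹ * ∫⁻ u, ∫⁻ x in Set.Ico u (u + T), S u x ^ 2 := by
        rw [lintegral_lintegral_swap hSm3.aemeasurable]
        congr 1
        refine lintegral_congr fun u => ?_
        rw [setLIntegral_Ico_add]
        simp_rw [add_comm u]
        rfl
    _ ≤ (ENNReal.ofReal T)⁻¹ * ∫⁻ u, c * ∫⁻ s in I, ‖g (s + u)‖ₑ ^ 2 := by
        gcongr with u
        exact hblock u
    _ = (ENNReal.ofReal T)⁻¹ * (c * ∫⁻ s in I, ∫⁻ u, ‖g (s + u)‖ₑ ^ 2) := by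
        rw [lintegral_const_mul' _ _ (by simp [hc]), lintegral_lintegral_swap]
        exact Continuous.aemeasurable (by fun_prop)
    _ = (ENNReal.ofReal T)⁻¹ * (c * (ENNReal.ofReal T * ∫⁻ t, ‖g t‖ₑ ^ 2)) := by
        simp_rw [fun s => lintegral_add_left_eq_self (μ := volume) (fun t => ‖g t‖ₑ ^ 2) s]
        rw [lintegral_const, hIv, mul_comm (ENNReal.ofReal T)]
    _ = c * ∫⁻ t, ‖g t‖ₑ ^ 2 := by
        rw [mul_left_comm c, ← mul_assoc, ENNReal.inv_mul_cancel (by simpa using hT) (by simp),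
          one_mul]
    _ = _ := by
        simp_rw [hgn]
        rw [lintegral_finsetSum _ fun n _ => (hh n).enorm.measurable.pow_const 2]

end GridAveraging

/-! ### Assembly of the bound O(1 + log N). -/

section MainBound

lemma add_sq_le_two_mul (a b : ℝ≥0∞) : (a + b) ^ 2 ≤ 2 * a ^ 2 + 2 * b ^ 2 := by
  have h := ENNReal.rpow_add_le_mul_rpow_add_rpow a b (p := 2) (by norm_num)
  norm_num at h
  rwa [mul_add] at h

/-- The maximal inequality, with `N ≤ 2 ^ L` frequencies. -/
theorem IsAdmissible.eLpNorm_maximalFn_le {χ : 𝓢(ℝ, ℂ)} (hχ : IsAdmissible χ) (k₀ : ℕ) {N : ℕ}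
    {θ : Fin N → ℝ} (hθ : OneSeparated θ) {f : ℝ → ℂ} (hf : MemLp f 2) {L : ℕ}
    (hL : N ≤ 2 ^ L) :
    eLpNorm (maximalFn χ θ k₀ f) 2 volume ≤
      ENNReal.ofReal (60 * (L + 1)) * eLpNorm f 2 volume := by
  set F : Lp ℂ 2 (volume : Measure ℝ) := 𝓕 (hf.toLp f) with hF
  set h : Fin N → ℝ → ℂ := fun n => 𝓕⁻ (band F (θ n)) with hh
  set V : ℕ → ℝ → ℂ := fun k x => ∑ n, ee (θ n * x) * tentAvg (h n) k x with hV
  set D : ℕ → ℝ → ℂ := fun k x => Xi χ θ k f x - V k x with hD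
  have hband := fun n => integrable_band (Lp.memLp F) (θ n)
  have hcont : ∀ n, Continuous (h n) := fun n => continuous_fourierInv (hband n)
  have hVc : ∀ k, Continuous (V k) := by
    intro k
    have h1 : ∀ n, Continuous fun x => tentAvg (h n) k x := by
      intro n
      simp_rw [hh, tentAvg_fourierInv (hband n)]
      refine continuous_fourierInv (integrable_mul_of_bounded (C := 1) (hband n) ?_ fun ξ => ?_)
      · have := continuous_avgMult k
        fun_prop
      · rw [norm_mul]
        exact mul_le_one₀ (norm_avgMult_le_one _ _) (norm_nonneg _) (norm_avgMult_le_one _ _)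
    fun_prop
  have hDc : ∀ k, Continuous (D k) := by
    intro k
    have e : D k = fun x => ∑ n, ee (θ n * x) * 𝓕⁻ (fun ξ => diffMult χ k ξ *
        band F (θ n) ξ) x := funext fun x => hχ.Xi_sub_eq hf θ k x
    rw [e]
    have h1 : ∀ n, Continuous fun x => 𝓕⁻ (fun ξ => diffMult χ k ξ * band F (θ n) ξ) x :=
      fun n => continuous_fourierInv (integrable_mul_of_bounded (hband n)
        (continuous_diffMult χ k) (hχ.norm_diffMult_le_const k))
    fun_prop
  have hXi : ∀ k x, Xi χ θ k f x = V k x + D k x := fun k x => by simp [hD]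
  -- Truncation at k ≤ K makes a finite tree enough; the bounds are uniform in K, and monotone
  -- convergence removes it.
  set M : ℕ → ℝ → ℝ≥0∞ := fun K x => ⨆ k ≤ K, ‖Xi χ θ k f x‖ₑ with hM
  have hMm : ∀ K, Measurable (M K) := fun K => by
    refine Measurable.iSup fun k => Measurable.iSup fun _ => ?_
    simp_rw [hXi]
    exact ((hVc k).add (hDc k)).enorm.measurable
  have hMmono : Monotone M := fun K K' hKK' x =>
    iSup₂_le fun k hk => le_iSup₂ (f := fun k (_ : k ≤ K') => ‖Xi χ θ k f x‖ₑ) k (hk.trans hKK')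
  have hDm : Measurable fun x => ∑' k, ‖D k x‖ₑ ^ 2 :=
    Measurable.tsum fun k => (hDc k).enorm.measurable.pow_const 2
  have hDint : ∫⁻ x, ∑' k, ‖D k x‖ₑ ^ 2 ≤ 1000 * ∫⁻ x, ‖f x‖ₑ ^ 2 := by
    rw [lintegral_tsum fun k => ((hDc k).enorm.measurable.pow_const 2).aemeasurable]
    exact hχ.lintegral_tsum_Xi_sub_sq_le hf hθ
  have hVint : ∀ K, ∫⁻ x, (⨆ k ≤ K, ‖V k x‖ₑ) ^ 2 ≤
      ENNReal.ofReal ((L + 1) * (4 + L * (18 * 32))) * ∫⁻ x, ‖f x‖ₑ ^ 2 := by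
    intro K
    refine (lintegral_iSup_tentAvg_sq_le hθ hcont hL K).trans ?_
    gcongr
    calc ∑ n, ∫⁻ x, ‖h n x‖ₑ ^ 2 = ∑ n, ∫⁻ ξ, ‖band F (θ n) ξ‖ₑ ^ 2 :=
          Finset.sum_congr rfl fun n _ =>
            lintegral_fourierInv_sq (hband n) (memLp_band (Lp.memLp F) _)
      _ ≤ ∫⁻ ξ, ‖F ξ‖ₑ ^ 2 := sum_lintegral_band_sq_le hθ (Lp.memLp F)
      _ = _ := by rw [← eLpNorm_two_sq, ← eLpNorm_two_sq, hF, eLpNorm_fourier_toLp]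
  have hMK : ∀ K, ∫⁻ x, M K x ^ 2 ≤
      ENNReal.ofReal ((60 * (L + 1)) ^ 2) * ∫⁻ x, ‖f x‖ₑ ^ 2 := by
    intro K
    calc ∫⁻ x, M K x ^ 2
        ≤ ∫⁻ x, (2 * (⨆ k ≤ K, ‖V k x‖ₑ) ^ 2 + 2 * ∑' k, ‖D k x‖ₑ ^ 2) := by
          refine lintegral_mono fun x => ?_
          have h1 : M K x ≤ (⨆ k ≤ K, ‖V k x‖ₑ) + (∑' k, ‖D k x‖ₑ ^ 2) ^ (1 / 2 : ℝ) := by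
            refine iSup₂_le fun k hk => ?_
            rw [hXi]
            refine (enorm_add_le _ _).trans (add_le_add
              (le_iSup₂ (f := fun k (_ : k ≤ K) => ‖V k x‖ₑ) k hk) ?_)
            refine le_trans (le_of_eq ?_)
              (ENNReal.rpow_le_rpow (ENNReal.le_tsum k) (by norm_num))
            rw [← ENNReal.rpow_natCast, ← ENNReal.rpow_mul]; norm_num
          calc M K x ^ 2 ≤ _ := by gcongr
            _ ≤ _ := add_sq_le_two_mul _ _
            _ = _ := by
              congr 2
              rw [← ENNReal.rpow_natCast, ← ENNReal.rpow_mul]; norm_num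
      _ = 2 * (∫⁻ x, (⨆ k ≤ K, ‖V k x‖ₑ) ^ 2) + 2 * ∫⁻ x, ∑' k, ‖D k x‖ₑ ^ 2 := by
          rw [lintegral_add_right _ (hDm.const_mul 2), lintegral_const_mul' _ _ (by norm_num),
            lintegral_const_mul' _ _ (by norm_num)]
      _ ≤ 2 * (ENNReal.ofReal ((L + 1) * (4 + L * (18 * 32))) * ∫⁻ x, ‖f x‖ₑ ^ 2) +
            2 * (1000 * ∫⁻ x, ‖f x‖ₑ ^ 2) := by
          gcongr
          exact hVint K
      _ = ENNReal.ofReal (2 * ((L + 1) * (4 + L * (18 * 32))) + 2 * 1000) *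
            ∫⁻ x, ‖f x‖ₑ ^ 2 := by
          rw [ENNReal.ofReal_add (by positivity) (by norm_num),
            ENNReal.ofReal_mul (p := 2) (by norm_num), ENNReal.ofReal_mul (p := 2) (by norm_num),
            ENNReal.ofReal_ofNat, ENNReal.ofReal_ofNat]
          ring
      -- 2(L + 1)(4 + 576L) + 2000 ≤ 3600(L + 1)².
      _ ≤ _ := by
          gcongr
          have : (0 : ℝ) ≤ L := Nat.cast_nonneg L
          nlinarith
  have hsq : eLpNorm (maximalFn χ θ k₀ f) 2 volume ^ 2 ≤
      (ENNReal.ofReal (60 * (L + 1)) * eLpNorm f 2 volume) ^ 2 := by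
    rw [mul_pow, eLpNorm_two_sq, eLpNorm_two_sq, ← ENNReal.ofReal_pow (by positivity)]
    calc ∫⁻ x, ‖maximalFn χ θ k₀ f x‖ₑ ^ 2 ≤ ∫⁻ x, ⨆ K, M K x ^ 2 := by
          refine lintegral_mono fun x => ?_
          rw [enorm_eq_self, ← ENNReal.iSup_pow]
          gcongr
          refine iSup₂_le fun k _ => ?_
          exact (le_iSup₂ (f := fun k' (_ : k' ≤ k) => ‖Xi χ θ k' f x‖ₑ) k le_rfl).trans
            (le_iSup (fun K => M K x) k)
      _ = ⨆ K, ∫⁻ x, M K x ^ 2 := by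
          refine lintegral_iSup (fun K => (hMm K).pow_const 2) fun K K' hKK' x => ?_
          exact pow_le_pow_left' (hMmono hKK' x) 2
      _ ≤ _ := iSup_le hMK
  exact (ENNReal.pow_le_pow_left_iff two_ne_zero).1 hsq

/-- For N ≥ 2, 2^(clog N − 1) ≤ N, and 1/log 2 ≤ 2. -/
lemma clog_add_one_le {N : ℕ} (hN : 1 ≤ N) : (Nat.clog 2 N + 1 : ℝ) ≤ 2 + 2 * Real.log N := by
  have hlog : 0 ≤ Real.log N := Real.log_natCast_nonneg N
  rcases Nat.eq_or_lt_of_le hN with rfl | hN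
  · simp
  have h1 : (2 : ℝ) ^ (Nat.clog 2 N).pred ≤ N := by
    exact_mod_cast (Nat.pow_pred_clog_lt_self (by norm_num) hN).le
  have h2 := Real.log_le_log (by positivity) h1
  rw [Real.log_pow] at h2
  have h3 : 0 < Nat.clog 2 N := Nat.clog_pos (by norm_num) hN
  have h4 : ((Nat.clog 2 N).pred : ℝ) = Nat.clog 2 N - 1 := by
    rw [Nat.pred_eq_sub_one, Nat.cast_sub h3]; simp
  rw [h4] at h2
  have h5 := Real.log_two_gt_d9
  have h6 : (1 : ℝ) ≤ Nat.clog 2 N := by exact_mod_cast h3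
  nlinarith

theorem IsAdmissible.eLpNorm_maximalFn_le_log {χ : 𝓢(ℝ, ℂ)} (hχ : IsAdmissible χ) (k₀ : ℕ)
    {N : ℕ} (hN : 1 ≤ N) {θ : Fin N → ℝ} (hθ : OneSeparated θ) {f : ℝ → ℂ} (hf : MemLp f 2) :
    eLpNorm (maximalFn χ θ k₀ f) 2 volume ≤
      ENNReal.ofReal (120 * (1 + Real.log N)) * eLpNorm f 2 volume := by
  refine (hχ.eLpNorm_maximalFn_le k₀ hθ hf (Nat.le_pow_clog (by norm_num) N)).trans ?_
  refine mul_le_mul_left (ENNReal.ofReal_le_ofReal ?_) _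
  linarith [clog_add_one_le hN]

end MainBound

end MultiFreq

end

/-! ### The two stated forms of the bound. -/

theorem mainTheorem1 :
    (∀ ε : ℝ, 0 < ε → ∃ C : ℝ≥0,
      ∀ (χ : 𝓢(ℝ, ℂ)), MultiFreq.IsAdmissible χ →
      ∀ (k₀ N : ℕ) (θ : Fin N → ℝ), MultiFreq.OneSeparated θ →
      ∀ f : ℝ → ℂ, MemLp f 2 volume →
        eLpNorm (MultiFreq.maximalFn χ θ k₀ f) 2 volume ≤
          C * ENNReal.ofReal ((N : ℝ) ^ ε) * eLpNorm f 2 volume) ∧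
    (∃ C : ℝ≥0,
      ∀ (χ : 𝓢(ℝ, ℂ)), MultiFreq.IsAdmissible χ →
      ∀ (k₀ N : ℕ), 2 ≤ N → ∀ (θ : Fin N → ℝ), MultiFreq.OneSeparated θ →
      ∀ f : ℝ → ℂ, MemLp f 2 volume →
        eLpNorm (MultiFreq.maximalFn χ θ k₀ f) 2 volume ≤
          C * ENNReal.ofReal (Real.log N ^ 2) * eLpNorm f 2 volume) := by
  constructor
  · intro ε hε
    refine ⟨(120 * (1 + 1 / ε)).toNNReal, fun χ hχ k₀ N θ hθ f hf => ?_⟩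
    -- For N = 0 the factor N^ε is 0, so the vanishing of the empty sum is needed.
    rcases Nat.eq_zero_or_pos N with rfl | hN
    · have : MultiFreq.maximalFn χ θ k₀ f = 0 := by
        ext x
        simp [MultiFreq.maximalFn, MultiFreq.Xi]
      simp [this]
    · refine (hχ.eLpNorm_maximalFn_le_log k₀ hN hθ hf).trans ?_
      gcongr
      rw [← ENNReal.ofReal, ← ENNReal.ofReal_mul (by positivity)]
      refine ENNReal.ofReal_le_ofReal ?_
      have h1 : (1 : ℝ) ≤ (N : ℝ) ^ ε := Real.one_le_rpow (by exact_mod_cast hN) hε.le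
      have h2 := Real.log_le_rpow_div (Nat.cast_nonneg N) hε
      have : 1 + Real.log N ≤ (1 + 1 / ε) * (N : ℝ) ^ ε := by
        rw [add_mul, one_div_mul_eq_div]; linarith
      linarith
  · refine ⟨480, fun χ hχ k₀ N hN θ hθ f hf => ?_⟩
    refine (hχ.eLpNorm_maximalFn_le_log k₀ (by omega) hθ hf).trans ?_
    gcongr
    rw [show ((480 : ℝ≥0) : ℝ≥0∞) = ENNReal.ofReal 480 by norm_num,
      ← ENNReal.ofReal_mul (by norm_num)]
    refine ENNReal.ofReal_le_ofReal ?_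
    -- With t = log N ≥ log 2 > 0.69, the constant term is absorbed: 120(1 + t) ≤ 480 t².
    have h1 : Real.log 2 ≤ Real.log N := Real.log_le_log (by norm_num) (by exact_mod_cast hN)
    have h2 := Real.log_two_gt_d9
    nlinarith
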